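/- Let $\Upsilon$ be a finite set, $\Omega=\Upsilon^{\mathbb Z^2}$ with the product $\sigma$-algebra, and for $V\subseteq\mathbb Z^2$ let $\mathcal F_V$ be the $\sigma$-algebra generated by the coordinates in $V$. Let $P$ be a probability measure on $\Omega$ such that 1. $P$ is stationary, i.e. invariant under all shifts $(\theta_v\omega)(u)=\omega(u+v)$, $v\in\mathbb Z^2$; 2. (strong $0$-$1$ law) for every $J\subseteq\mathbb Z^2$ the $\sigma$-algebra $\mathcal F_J$ coincides modulo $P$ with $\mathcal F_J^*:=\bigcap_{V\subset\mathbb Z^2\text{ finite}}\mathcal F_{J\cup(\mathbb Z^2\setminus V)}$; 3. (uniform lower bound) there is $c>0$ such that $P[\omega_0=y\mid A]>c$ for all $y\in\Upsilon$ and all $A\in\mathcal F_{\mathbb Z^2\setminus\{0\}}$ with $P(A)>0$. For $\lambda,a\in\mathbb R$ and $U\subseteq\mathbb Z$ let $L_{\lambda,a}(U)=\{(z,\lfloor\lambda z+a\rfloor): z\in U\}$ be the lattice approximation of the line $x\mapsto\lambda x+a$. To include lines represented as functions of the $y$-axis and reflected approximations as well, fix an automorphism $\sigma$ of the group $\mathbb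 Z^2$ ($\sigma=\mathrm{id}$ for lines over the $x$-axis, the swap of the two coordinates for lines over the $y$-axis, sign changes for reflections) and put $L^\sigma_{\lambda,a}(U)=\sigma(L_{\lambda,a}(U))$. Let $\mathcal P^\sigma_{\lambda,a}=\mathcal F_{L^\sigma_{\lambda,a}(\{z\in\mathbb Z:\, z\le -1\})}$ be the corresponding past. For finite $V$ write $\mathcal I(P_V)(\omega)=-\log P[\{\eta:\eta_V=\omega_V\}]$ for the information in $\omega_V$. Let $P_0[\,\cdot\mid\mathcal G](\omega)$ be the conditional distribution of $\omega_0$ given a $\sigma$-algebra $\mathcal G$, and $H(p)=-\sum_{y\in\Upsilon}p(y)\log p(y)$. Let $\lambda\in\mathbb R$ be irrational. Then $\omega\mapsto H(P_0[\,\cdot\mid\mathcal P^\sigma_{\lambda,t}](\omega))$ is $P$-integrable for every $t$, the function $t\mapsto E\big[H(P_0[\,\cdot\mid\mathcal P^\sigma_{\lambda,t}](\omega))\big]$ is integrable on $[0,1]$, and for every $a\in\mathbb R$ the functions $\mathcal I(P_{L^\sigma_{\lambda,a}(\{0,\dots,n\})})$ are in $L^1(P)$ and $$\frac1{n+1}\,\mathcal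 I\big(P_{L^\sigma_{\lambda,a}(\{0,\dots,n\})}\big)\ \xrightarrow[n\to\infty]{}\ \int_0^1 E\big[H\big(P_0[\,\cdot\mid\mathcal P^\sigma_{\lambda,t}](\omega)\big)\big]\,dt\qquad\text{in }L^1(P).$$ -/

import Mathlib

open MeasureTheory ProbabilityTheory Filter Topology

namespace RandomField

/-- The lattice `ℤ²`. -/
abbrev Site : Type := ℤ × ℤ

/-- Configurations on the lattice with values in the alphabet `Υ`; the σ-algebra is the product
one. -/
abbrev Config (Υ : Type*) : Type _ := Site → Υ

section

variable {Υ : Type*} [MeasurableSpace Υ]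

/-- The shift `(θ_v ω)(u) = ω (u + v)`. -/
def shift (v : Site) (ω : Config Υ) : Config Υ := fun u => ω (u + v)

/-- `P` is invariant under all shifts. -/
def Stationary (P : Measure (Config Υ)) : Prop :=
  ∀ v : Site, MeasurePreserving (shift v) P P

/-- `ℱ_V`, the σ-algebra generated by the coordinates in `V`. -/
abbrev sigmaAt (Υ : Type*) [MeasurableSpace Υ] (V : Set Site) : MeasurableSpace (Config Υ) :=
  cylinderEvents (X := fun _ : Site => Υ) V

/-- `ℱ_J^*`, the intersection over finite `V` of the σ-algebras `ℱ_{J ∪ Vᶜ}`. -/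
abbrev sigmaStar (Υ : Type*) [MeasurableSpace Υ] (J : Set Site) : MeasurableSpace (Config Υ) :=
  ⨅ V : Finset Site, sigmaAt Υ (J ∪ (V : Set Site)ᶜ)

/-- Two σ-algebras coincide modulo `P`: each event of one agrees `P`-almost surely with an event of
the other. -/
def EqModulo (P : Measure (Config Υ)) (m₁ m₂ : MeasurableSpace (Config Υ)) : Prop :=
  (∀ A, MeasurableSet[m₁] A → ∃ B, MeasurableSet[m₂] B ∧ A =ᵐ[P] B) ∧
    (∀ B, MeasurableSet[m₂] B → ∃ A, MeasurableSet[m₁] A ∧ B =ᵐ[P] A)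

/-- The strong 0-1 law. -/
def StrongZeroOneLaw (P : Measure (Config Υ)) : Prop :=
  ∀ J : Set Site, EqModulo P (sigmaAt Υ J) (sigmaStar Υ J)

/-- There is `c > 0` such that, conditionally on any (non-null) event `A` which does not depend on
the origin, every letter appears at the origin with probability larger than `c`. -/
def UniformLowerBound (P : Measure (Config Υ)) : Prop :=
  ∃ c : ℝ, 0 < c ∧ ∀ A : Set (Config Υ), MeasurableSet[sigmaAt Υ {(0 : Site)}ᶜ] A → P A ≠ 0 →
    ∀ y : Υ, c < (P[|A]).real {ω | ω 0 = y}

/-- The information `ℐ(P_V)(ω) = -log P[ω_V]`. -/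
noncomputable def information (P : Measure (Config Υ)) (V : Set Site) (ω : Config Υ) : ℝ :=
  -Real.log (P.real {η | ∀ v ∈ V, η v = ω v})

/-- The conditional distribution `P_0[· | m](ω)` of the letter at the origin, as a function on the
alphabet. -/
noncomputable def condLawZero (P : Measure (Config Υ)) (m : MeasurableSpace (Config Υ))
    (ω : Config Υ) (y : Υ) : ℝ :=
  (P⟦{η : Config Υ | η 0 = y}|m⟧) ω

/-- Shannon entropy `-∑ p(y) log p(y)` (with `0 log 0 = 0`). -/
noncomputable def shannonEntropy {Υ : Type*} [Fintype Υ] (p : Υ → ℝ) : ℝ :=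
  ∑ y, Real.negMulLog (p y)

end

/-- The lattice approximation `{(z, ⌊slope * z + a⌋) | z ∈ U}` of the line with slope `slope` and
intercept `a`, read in the lattice coordinates given by the automorphism `σ` of `ℤ²`. The choice
`σ = id` represents the line as a function of the `x`-axis, the coordinate swap represents it as a
function of the `y`-axis, and `σ = -id` (or a sign change of one coordinate) gives the reflected
approximations. -/
def latticeApprox (σ : Site ≃+ Site) (slope a : ℝ) (U : Set ℤ) : Set Site :=
  (fun z : ℤ => σ (z, ⌊slope * z + a⌋)) '' U

/-- The past σ-algebra generated by the sites of the lattice approximation over `(-∞, -1]`. -/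
abbrev past (Υ : Type*) [MeasurableSpace Υ] (σ : Site ≃+ Site) (slope a : ℝ) :
    MeasurableSpace (Config Υ) :=
  sigmaAt Υ (latticeApprox σ slope a (Set.Iic (-1)))

end RandomField

open RandomField

/-! Write λ for the slope. Peeling sites off the right end of the window, stationarity turns the
information of the first n sites into a sum over k < n: the k-th term is the conditional information
of the letter at the origin, given the line of intercept {λk + a} over [-k, 0), evaluated at a
shifted configuration (`information_ae_eq_sum`). The summands change with k and the shifts are not
iterates of one map, so no standard ergodic theorem applies directly.

The strong 0-1 law makes J ↦ P[f | ℱ_J] continuous into L¹: martingale convergence handles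
approximation of J from inside, Lévy's downward theorem approximation from outside. Subsets of ℤ²
form a compact space, so the continuity is uniform (`exists_box_condExp_lt`). The lower bound c
makes the logarithm Lipschitz on the relevant range, and conditional informations inherit this
(`exists_box_integral_condInfo_sub_lt`). Up to a small L¹ error uniform in k, each past can thus be
replaced by its trace on one fixed box.

For a fixed box only finitely many functions occur. Their fluctuations average out: the 0-1 law at J
= ∅ is tail triviality, so correlations decay and a second-moment bound suffices
(`tendsto_integral_abs_average_centeredInfo`). Their means are a function of {λk + a} with finitely
many discontinuities on the circle, so Weyl equidistribution gives the integral over the intercept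
(`tendsto_average_latticeApprox_inter_box`). Mean conditional information is mean entropy
(`integral_condInfo`). -/

/-! ### Lévy's downward theorem via projections in L². -/

section LevyDownward

variable {Ω : Type*} {m0 : MeasurableSpace Ω} {μ : Measure Ω}

/-- Orthogonal projections onto a decreasing sequence of closed subspaces converge strongly. -/
theorem Submodule.starProjection_tendsto_iInf {E : Type*} [NormedAddCommGroup E]
    [InnerProductSpace ℝ E] [CompleteSpace E] (U : ℕ → Submodule ℝ E)
    [∀ i, (U i).HasOrthogonalProjection] [(⨅ i, U i).HasOrthogonalProjection]
    (hU : Antitone U) (x : E) :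
    Tendsto (fun i => (U i).starProjection x) atTop (𝓝 ((⨅ i, U i).starProjection x)) := by
  -- The complements increase, so the convergence theorem for increasing families applies to them.
  have hclosure : (⨆ i, (U i)ᗮ).topologicalClosure = (⨅ i, U i)ᗮ := by
    rw [← Submodule.orthogonal_orthogonal_eq_closure, ← Submodule.iInf_orthogonal]
    simp only [Submodule.orthogonal_orthogonal]
  have key := Submodule.starProjection_tendsto_closure_iSup (fun i => (U i)ᗮ)
    (fun i j hij => Submodule.orthogonal_le (hU hij)) x
  have hlim : (⨆ i, (U i)ᗮ).topologicalClosure.starProjection x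
      = x - (⨅ i, U i).starProjection x := by
    have : (⨆ i, (U i)ᗮ).topologicalClosure.starProjection x
        = ((⨅ i, U i)ᗮ).starProjection x := by congr!
    rw [this, Submodule.starProjection_orthogonal']
    simp
  rw [hlim] at key
  have h2 := key.const_sub x
  simp only [Submodule.starProjection_orthogonal', sub_apply, one_apply_eq_self,
    sub_sub_cancel] at h2
  exact h2

/-- The limsup of the versions ignores any initial segment, hence is measurable for every `m k` at
once. -/
theorem MeasureTheory.AEStronglyMeasurable.iInf_of_antitone {m : ℕ → MeasurableSpace Ω}
    (hm : Antitone m) {f : Ω → ℝ} (hf : ∀ n, AEStronglyMeasurable[m n] f μ) :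
    AEStronglyMeasurable[⨅ n, m n] f μ := by
  choose g hg hfg using hf
  refine ⟨fun ω => limsup (fun n => g n ω) atTop, ?_, ?_⟩
  · have hmeas : Measurable[⨅ n, m n] (fun ω => limsup (fun n => g n ω) atTop) := by
      intro s hs
      rw [MeasurableSpace.measurableSet_iInf]
      intro k
      have : (fun ω => limsup (fun n => g n ω) atTop)
          = fun ω => limsup (fun n => g (n + k) ω) atTop := by
        funext ω
        exact (limsup_nat_add (fun n => g n ω) k).symm
      rw [this]
      have h : Measurable[m k] (fun ω => limsup (fun n => g (n + k) ω) atTop) :=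
        Measurable.limsup fun n =>
          ((hg (n + k)).mono (hm (Nat.le_add_left k n))).measurable
      exact h hs
    exact hmeas.stronglyMeasurable
  · filter_upwards [ae_all_iff.2 hfg] with ω hω
    simp [← hω]

/-- Identifies the limiting projection as conditional expectation given the intersection. -/
theorem lpMeas_iInf_of_antitone {m : ℕ → MeasurableSpace Ω} (hm : Antitone m) :
    (⨅ n, lpMeas ℝ ℝ (m n) 2 μ) = lpMeas ℝ ℝ (⨅ n, m n) 2 μ := by
  ext f
  simp only [Submodule.mem_iInf, mem_lpMeas_iff_aestronglyMeasurable]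
  exact ⟨fun h => AEStronglyMeasurable.iInf_of_antitone hm h,
    fun h n => h.mono (iInf_le _ n)⟩

/-- **Lévy's downward theorem** for square-integrable functions. -/
theorem tendsto_eLpNorm_condExp_iInf [IsProbabilityMeasure μ] {m : ℕ → MeasurableSpace Ω}
    (hm : Antitone m) (hle : ∀ n, m n ≤ m0) {f : Ω → ℝ} (hf : MemLp f 2 μ) :
    Tendsto (fun n => eLpNorm (μ[f | m n] - μ[f | ⨅ n, m n]) 1 μ) atTop (𝓝 0) := by
  have hle' : (⨅ n, m n) ≤ m0 := (iInf_le m 0).trans (hle 0)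
  have (n : ℕ) : Fact (m n ≤ m0) := ⟨hle n⟩
  have : Fact ((⨅ n, m n) ≤ m0) := ⟨hle'⟩
  have inst : (⨅ n, lpMeas ℝ ℝ (m n) 2 μ).HasOrthogonalProjection := by
    rw [lpMeas_iInf_of_antitone hm]; infer_instance
  have key := Submodule.starProjection_tendsto_iInf (fun n => lpMeas ℝ ℝ (m n) 2 μ)
    (fun i j hij g hg => mem_lpMeas_iff_aestronglyMeasurable.2
      ((mem_lpMeas_iff_aestronglyMeasurable.1 hg).mono (hm hij))) (hf.toLp f)
  have hlim : (⨅ n, lpMeas ℝ ℝ (m n) 2 μ).starProjection (hf.toLp f)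
      = (lpMeas ℝ ℝ (⨅ n, m n) 2 μ).starProjection (hf.toLp f) := by
    congr!
    exact lpMeas_iInf_of_antitone hm
  rw [hlim, Lp.tendsto_Lp_iff_tendsto_eLpNorm'] at key
  have h1 : ∀ n, eLpNorm (μ[f | m n] - μ[f | ⨅ n, m n]) 1 μ ≤
      eLpNorm ((((lpMeas ℝ ℝ (m n) 2 μ).starProjection (hf.toLp f) : Lp ℝ 2 μ) : Ω → ℝ) -
        (((lpMeas ℝ ℝ (⨅ n, m n) 2 μ).starProjection (hf.toLp f) : Lp ℝ 2 μ) : Ω → ℝ)) 2 μ := by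
    intro n
    have e1 := hf.condExpL2_ae_eq_condExp (𝕜 := ℝ) (hle n)
    have e2 := hf.condExpL2_ae_eq_condExp (𝕜 := ℝ) hle'
    calc _ ≤ eLpNorm (μ[f | m n] - μ[f | ⨅ n, m n]) 2 μ :=
          eLpNorm_le_eLpNorm_of_exponent_le one_le_two
            (integrable_condExp.aestronglyMeasurable.sub integrable_condExp.aestronglyMeasurable)
      _ = _ := eLpNorm_congr_ae (e1.symm.sub e2.symm)
  exact tendsto_of_tendsto_of_tendsto_of_le_of_le tendsto_const_nhds key
    (fun _ => zero_le) h1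

end LevyDownward

/-! ### Comparing conditional expectations. -/

section CondExp

variable {Ω : Type*} {m0 : MeasurableSpace Ω} {μ : Measure Ω} [IsProbabilityMeasure μ]

/-- By the tower property the left difference is the conditional expectation of the right one given
`m₂`, and conditioning contracts L¹. -/
theorem eLpNorm_condExp_sub_condExp_le {m₁ m₂ m₃ : MeasurableSpace Ω} (h₁₂ : m₁ ≤ m₂)
    (h₂₃ : m₂ ≤ m₃) (h₃ : m₃ ≤ m0) (f : Ω → ℝ) :
    eLpNorm (μ[f | m₂] - μ[f | m₁]) 1 μ ≤ eLpNorm (μ[f | m₃] - μ[f | m₁]) 1 μ := by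
  have h₂ := h₂₃.trans h₃
  have h : μ[μ[f | m₃] - μ[f | m₁] | m₂] =ᵐ[μ] μ[f | m₂] - μ[f | m₁] := by
    have e₁ := condExp_sub (μ := μ) (integrable_condExp (m := m₃) (f := f) (μ := μ))
      (integrable_condExp (m := m₁) (f := f) (μ := μ)) m₂
    have e₂ := condExp_condExp_of_le (μ := μ) (f := f) h₂₃ h₃
    have e₃ : μ[μ[f | m₁] | m₂] = μ[f | m₁] := condExp_of_stronglyMeasurable h₂
      (stronglyMeasurable_condExp.mono h₁₂) integrable_condExp
    rw [e₃] at e₁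
    exact e₁.trans (e₂.sub .rfl)
  rw [← eLpNorm_congr_ae h]
  exact eLpNorm_condExp_le_eLpNorm _ le_rfl

/-- The defining set integrals do not see null sets. -/
theorem condExp_ae_eq_of_forall_ae_eq {m₁ m₂ : MeasurableSpace Ω} (h₁₂ : m₁ ≤ m₂) (h₂ : m₂ ≤ m0)
    (h : ∀ B, MeasurableSet[m₂] B → ∃ A, MeasurableSet[m₁] A ∧ B =ᵐ[μ] A) {f : Ω → ℝ}
    (hf : Integrable f μ) : μ[f | m₁] =ᵐ[μ] μ[f | m₂] := by
  refine ae_eq_condExp_of_forall_setIntegral_eq h₂ hf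
    (fun s _ _ => integrable_condExp.integrableOn) (fun s hs _ => ?_)
    (stronglyMeasurable_condExp.mono h₁₂).aestronglyMeasurable
  obtain ⟨A, hA, hsA⟩ := h s hs
  rw [setIntegral_congr_set hsA, setIntegral_congr_set hsA,
    setIntegral_condExp (h₁₂.trans h₂) hf hA]

end CondExp

/-! ### Uniform continuity of J ↦ P[f | ℱ_J]. -/

namespace RandomField

/-- The square box of radius `n` around the origin. -/
noncomputable def box (n : ℕ) : Finset Site := Finset.Icc (-(n : ℤ), -(n : ℤ)) ((n : ℤ), (n : ℤ))

theorem mem_box {n : ℕ} {v : Site} : v ∈ box n ↔ |v.1| ≤ n ∧ |v.2| ≤ n := by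
  simp only [box, Finset.mem_Icc, Prod.le_def, abs_le]
  tauto

theorem box_mono : Monotone box := by
  intro m n h v hv
  rw [mem_box] at hv ⊢
  omega

theorem exists_subset_box (V : Finset Site) : ∃ n, V ⊆ box n := by
  refine ⟨V.sup fun v => (max |v.1| |v.2|).toNat, fun v hv => ?_⟩
  have h := Finset.le_sup (f := fun v : Site => (max |v.1| |v.2|).toNat) hv
  rw [mem_box]
  omega

theorem exists_mem_box (v : Site) : ∃ n, v ∈ box n := by
  obtain ⟨n, hn⟩ := exists_subset_box {v}
  exact ⟨n, hn (by simp)⟩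

variable {Υ : Type*} [MeasurableSpace Υ] {P : Measure (Config Υ)} [IsProbabilityMeasure P]

theorem iSup_sigmaAt_inter_box (J : Set Site) :
    ⨆ n, sigmaAt Υ (J ∩ box n) = sigmaAt Υ J := by
  apply le_antisymm
  · exact iSup_le fun n => cylinderEvents_mono Set.inter_subset_left
  · refine iSup₂_le fun v hv => ?_
    obtain ⟨n, hn⟩ := exists_mem_box v
    exact le_trans (le_iSup₂_of_le v ⟨hv, hn⟩ le_rfl) (le_iSup (fun n => sigmaAt Υ (J ∩ box n)) n)

theorem iInf_sigmaAt_union_compl_box (J : Set Site) :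
    ⨅ n, sigmaAt Υ (J ∪ (box n : Set Site)ᶜ) = sigmaStar Υ J := by
  apply le_antisymm
  · refine le_iInf fun V => ?_
    obtain ⟨n, hn⟩ := exists_subset_box V
    refine (iInf_le _ n).trans (cylinderEvents_mono ?_)
    gcongr
  · exact le_iInf fun n => iInf_le _ (box n)

theorem tendsto_condExp_inter_box (P : Measure (Config Υ)) [IsProbabilityMeasure P]
    (f : Config Υ → ℝ) (J : Set Site) :
    Tendsto (fun n => eLpNorm (P[f | sigmaAt Υ (J ∩ box n)] - P[f | sigmaAt Υ J]) 1 P) atTop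
      (𝓝 0) := by
  have := tendsto_eLpNorm_condExp (μ := P) (ℱ := ⟨fun n => sigmaAt Υ (J ∩ box n),
    fun m n h => cylinderEvents_mono (by gcongr; exact box_mono h),
    fun n => cylinderEvents_le_pi⟩) f
  simpa only [iSup_sigmaAt_inter_box] using! this

/-- Lévy's downward theorem gives the limit given `sigmaStar`; the 0-1 law replaces that σ-algebra
by ℱ_J. -/
theorem tendsto_condExp_union_compl_box (h01 : StrongZeroOneLaw P) {f : Config Υ → ℝ}
    (hf : MemLp f 2 P) (J : Set Site) :
    Tendsto (fun n => eLpNorm (P[f | sigmaAt Υ (J ∪ (box n : Set Site)ᶜ)] - P[f | sigmaAt Υ J]) 1 P)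
      atTop (𝓝 0) := by
  have h := tendsto_eLpNorm_condExp_iInf (μ := P)
    (m := fun n => sigmaAt Υ (J ∪ (box n : Set Site)ᶜ))
    (fun m n h => cylinderEvents_mono (by gcongr; exact box_mono h))
    (fun n => cylinderEvents_le_pi) hf
  have hJ : sigmaAt Υ J ≤ sigmaStar Υ J :=
    le_iInf fun V => cylinderEvents_mono Set.subset_union_left
  have hle : sigmaStar Υ J ≤ MeasurableSpace.pi := (iInf_le _ ∅).trans cylinderEvents_le_pi
  have e := condExp_ae_eq_of_forall_ae_eq hJ hle (h01 J).2 (hf.integrable one_le_two)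
  refine h.congr fun n => eLpNorm_congr_ae ?_
  simp only [iInf_sigmaAt_union_compl_box]
  exact EventuallyEq.rfl.sub e.symm

/-- Such a J' lies between J ∩ box and J ∪ boxᶜ, and the conditional expectations for both bounds
are close to that for J. -/
theorem exists_box_condExp_lt_of_inter_eq (h01 : StrongZeroOneLaw P) {f : Config Υ → ℝ}
    (hf : MemLp f 2 P) (J : Set Site) {ε : ENNReal} (hε : ε ≠ 0) :
    ∃ n, ∀ J' : Set Site, J' ∩ box n = J ∩ box n →
      eLpNorm (P[f | sigmaAt Υ J'] - P[f | sigmaAt Υ J]) 1 P < ε := by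
  have h₁ := tendsto_condExp_inter_box P f J
  have h₂ := tendsto_condExp_union_compl_box h01 hf J
  -- The inner approximation is paid for twice: once to compare J' with it, once to return to J.
  have h := (h₂.add h₁).add h₁
  simp only [add_zero] at h
  obtain ⟨n, hn⟩ := (h.eventually (gt_mem_nhds (pos_iff_ne_zero.2 hε))).exists
  refine ⟨n, fun J' hJ' => lt_of_le_of_lt ?_ hn⟩
  have hm (K : Set Site) : AEStronglyMeasurable (P[f | sigmaAt Υ K]) P :=
    integrable_condExp.aestronglyMeasurable
  have hcontr := eLpNorm_condExp_sub_condExp_le (μ := P) (m₁ := sigmaAt Υ (J ∩ box n))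
    (m₂ := sigmaAt Υ J') (m₃ := sigmaAt Υ (J ∪ (box n : Set Site)ᶜ))
    (cylinderEvents_mono (by rw [← hJ']; exact Set.inter_subset_left))
    (cylinderEvents_mono (by
      intro v hv
      by_cases hvn : v ∈ (box n : Set Site)
      · exact Or.inl ((Set.ext_iff.1 hJ' v).1 ⟨hv, hvn⟩).1
      · exact Or.inr hvn)) cylinderEvents_le_pi f
  have htri (K₁ K₂ K₃ : Set Site) : eLpNorm (P[f | sigmaAt Υ K₁] - P[f | sigmaAt Υ K₃]) 1 P ≤
      eLpNorm (P[f | sigmaAt Υ K₁] - P[f | sigmaAt Υ K₂]) 1 P +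
        eLpNorm (P[f | sigmaAt Υ K₂] - P[f | sigmaAt Υ K₃]) 1 P := by
    rw [← sub_add_sub_cancel _ (P[f | sigmaAt Υ K₂]) _]
    exact eLpNorm_add_le ((hm _).sub (hm _)) ((hm _).sub (hm _)) le_rfl
  calc _ ≤ _ := htri J' (J ∩ box n) J
    _ ≤ _ := by
      gcongr
      refine hcontr.trans ((htri _ J _).trans ?_)
      rw [eLpNorm_sub_comm (P[f | sigmaAt Υ J])]

/-- A function of `J ⊆ ℤ²` which is continuous for the product topology is uniformly so. -/
theorem exists_box_of_locally {p : Set Site → Set Site → ENNReal → Prop}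
    (hcomm : ∀ J J' ε, p J J' ε → p J' J ε)
    (htrans : ∀ J₁ J₂ J₃ ε₁ ε₂, p J₁ J₂ ε₁ → p J₂ J₃ ε₂ → p J₁ J₃ (ε₁ + ε₂))
    (hloc : ∀ (J : Set Site) (ε : ENNReal), ε ≠ 0 →
      ∃ n, ∀ J' : Set Site, J' ∩ box n = J ∩ box n → p J' J ε) {ε : ENNReal} (hε : ε ≠ 0) :
    ∃ n, ∀ J J' : Set Site, J ∩ box n = J' ∩ box n → p J J' ε := by
  have hε2 : ε / 2 ≠ 0 := by simpa using hε
  -- Subsets are coded as points of the compact space `Site → Bool`, where agreement on a box is an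
  -- open condition.
  let S : (Site → Bool) → Set Site := fun b => {v | b v = true}
  choose N hN using fun J => hloc J (ε / 2) hε2
  let O : (Site → Bool) → Set (Site → Bool) := fun b => {b' | ∀ v ∈ box (N (S b)), b' v = b v}
  have hO (b) : IsOpen (O b) := by
    have : O b = ⋂ v ∈ box (N (S b)), {b' : Site → Bool | b' v = b v} := by
      ext; simp [O]
    rw [this]
    refine isOpen_biInter_finset fun v _ => ?_
    have hs : IsOpen ({b v} : Set Bool) := isOpen_discrete _
    exact hs.preimage (continuous_apply v : Continuous fun b' : Site → Bool => b' v)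
  obtain ⟨t, ht⟩ := (isCompact_univ (X := Site → Bool)).elim_finite_subcover O hO
    (fun b _ => Set.mem_iUnion.2 ⟨b, fun _ _ => rfl⟩)
  refine ⟨t.sup fun b => N (S b), fun J J' hJ => ?_⟩
  classical
  have hmem := ht (Set.mem_univ fun v => decide (v ∈ J))
  simp only [Set.mem_iUnion] at hmem
  obtain ⟨b, hb, hJb⟩ := hmem
  have hsub : box (N (S b)) ⊆ box (t.sup fun b => N (S b)) :=
    box_mono (Finset.le_sup (f := fun b => N (S b)) hb)
  have h₁ : J ∩ box (N (S b)) = S b ∩ box (N (S b)) := by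
    ext v
    simp only [Set.mem_inter_iff, Finset.mem_coe, and_congr_left_iff]
    intro hv
    have := hJb v hv
    simp only [S, Set.mem_ofPred_eq, ← this, decide_eq_true_eq]
  have h₂ : J' ∩ box (N (S b)) = S b ∩ box (N (S b)) := by
    rw [← h₁]
    ext v
    simp only [Set.mem_inter_iff, Finset.mem_coe, and_congr_left_iff]
    intro hv
    have := Set.ext_iff.1 hJ v
    simp only [Set.mem_inter_iff, Finset.mem_coe, hsub hv, and_true] at this
    exact this.symm
  have := htrans _ _ _ _ _ (hN (S b) J h₁) (hcomm _ _ _ (hN (S b) J' h₂))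
  rwa [ENNReal.add_halves] at this

theorem exists_box_condExp_lt (h01 : StrongZeroOneLaw P) {f : Config Υ → ℝ}
    (hf : MemLp f 2 P) {ε : ENNReal} (hε : ε ≠ 0) :
    ∃ n, ∀ J J' : Set Site, J ∩ box n = J' ∩ box n →
      eLpNorm (P[f | sigmaAt Υ J] - P[f | sigmaAt Υ J']) 1 P < ε := by
  have hm (K : Set Site) : AEStronglyMeasurable (P[f | sigmaAt Υ K]) P :=
    integrable_condExp.aestronglyMeasurable
  refine exists_box_of_locally
    (p := fun J J' ε => eLpNorm (P[f | sigmaAt Υ J] - P[f | sigmaAt Υ J']) 1 P < ε)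
    (fun J J' ε h => by rwa [eLpNorm_sub_comm]) (fun J₁ J₂ J₃ ε₁ ε₂ h₁ h₂ => ?_)
    (fun J ε hε => exists_box_condExp_lt_of_inter_eq h01 hf J hε) hε
  rw [← sub_add_sub_cancel _ (P[f | sigmaAt Υ J₂]) _]
  exact (eLpNorm_add_le ((hm _).sub (hm _)) ((hm _).sub (hm _)) le_rfl).trans_lt
    (ENNReal.add_lt_add h₁ h₂)

end RandomField

/-! ### Conditional information of one letter. -/

theorem Real.abs_log_sub_log_le_of_le {c x y : ℝ} (hc : 0 < c) (hx : c ≤ x) (hy : c ≤ y) :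
    |Real.log x - Real.log y| ≤ c⁻¹ * |x - y| := by
  have key {x y : ℝ} (hx : c ≤ x) (hy : c ≤ y) :
      Real.log x - Real.log y ≤ c⁻¹ * |x - y| := by
    have hx0 := hc.trans_le hx
    have hy0 := hc.trans_le hy
    have h := Real.log_le_sub_one_of_pos (div_pos hx0 hy0)
    rw [Real.log_div hx0.ne' hy0.ne'] at h
    calc _ ≤ x / y - 1 := h
      _ = y⁻¹ * (x - y) := by field_simp
      _ ≤ y⁻¹ * |x - y| := by gcongr; exact le_abs_self _
      _ ≤ c⁻¹ * |x - y| := by gcongr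
  rw [abs_le]
  have h₁ := key hx hy
  have h₂ := key hy hx
  rw [abs_sub_comm] at h₂
  constructor <;> linarith

namespace RandomField

variable {Υ : Type*} [MeasurableSpace Υ] {P : Measure (Config Υ)}

/-- Conditionally on any non-null event not depending on the origin, every letter appears at the
origin with probability larger than `c`. -/
def LetterLowerBound (P : Measure (Config Υ)) (c : ℝ) : Prop :=
  ∀ A : Set (Config Υ), MeasurableSet[sigmaAt Υ {(0 : Site)}ᶜ] A → P A ≠ 0 →
    ∀ y : Υ, c < (P[|A]).real {ω | ω 0 = y}

/-- The conditional information `-log P[ω_0 | ω_J]` of the letter at the origin. -/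
noncomputable def condInfo (P : Measure (Config Υ)) (J : Set Site) (ω : Config Υ) : ℝ :=
  -Real.log (condLawZero P (sigmaAt Υ J) ω (ω 0))

theorem measurable_condLawZero (J : Set Site) (y : Υ) :
    Measurable fun ω => condLawZero P (sigmaAt Υ J) ω y :=
  (stronglyMeasurable_condExp.mono cylinderEvents_le_pi).measurable

theorem measurableSet_letter [DiscreteMeasurableSpace Υ] (v : Site) (y : Υ) :
    MeasurableSet {ω : Config Υ | ω v = y} :=
  (measurable_pi_apply (X := fun _ : Site => Υ) v) (MeasurableSet.of_discrete (s := {y}))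

/-- Separates the random letter from weights depending only on ω_J, so that measurability and
expectations can be treated letter by letter. -/
theorem condInfo_eq_sum [Fintype Υ] (P : Measure (Config Υ)) (J : Set Site) (ω : Config Υ) :
    condInfo P J ω = ∑ y, ({ω : Config Υ | ω 0 = y}.indicator fun _ => (1 : ℝ)) ω *
      -Real.log (condLawZero P (sigmaAt Υ J) ω y) := by
  classical
  rw [Finset.sum_eq_single (ω 0)]
  · simp [condInfo]
  · intro y _ hy
    simp [hy.symm]
  · simp

theorem measurable_condInfo [Fintype Υ] [DiscreteMeasurableSpace Υ] (J : Set Site) : Measurable (condInfo P J) := by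
  have : condInfo P J = fun ω => ∑ y, ({ω : Config Υ | ω 0 = y}.indicator fun _ => (1 : ℝ)) ω *
      -Real.log (condLawZero P (sigmaAt Υ J) ω y) := funext (condInfo_eq_sum P J)
  rw [this]
  refine Finset.measurable_sum _ fun y _ => ?_
  exact (measurable_const.indicator (measurableSet_letter 0 y)).mul
    (measurable_condLawZero J y).log.neg

theorem condLawZero_nonneg (J : Set Site) (y : Υ) :
    ∀ᵐ ω ∂P, 0 ≤ condLawZero P (sigmaAt Υ J) ω y :=
  condExp_nonneg (ae_of_all _ fun _ => Set.indicator_nonneg (by simp) _)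

variable [IsProbabilityMeasure P]

theorem memLp_letter [DiscreteMeasurableSpace Υ] (y : Υ) (p : ENNReal) :
    MemLp ({ω : Config Υ | ω 0 = y}.indicator fun _ => (1 : ℝ)) p P :=
  memLp_indicator_const p (measurableSet_letter 0 y) 1 (Or.inr (measure_ne_top _ _))

theorem condLawZero_le_one [DiscreteMeasurableSpace Υ] (J : Set Site) (y : Υ) :
    ∀ᵐ ω ∂P, condLawZero P (sigmaAt Υ J) ω y ≤ 1 := by
  have h := condExp_mono (m := sigmaAt Υ J) (μ := P) ((memLp_letter y 1).integrable le_rfl)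
    (integrable_const (1 : ℝ))
    (ae_of_all _ fun ω => Set.indicator_le_self' (fun _ _ => zero_le_one) ω)
  rw [condExp_const (cylinderEvents_le_pi)] at h
  exact h

/-- If the conditional probability were below c on a non-null event of ℱ_J, its average there would
contradict the lower bound for that event. -/
theorem le_condLawZero [DiscreteMeasurableSpace Υ] {c : ℝ} (hc : LetterLowerBound P c)
    {J : Set Site} (hJ : (0 : Site) ∉ J) (y : Υ) :
    ∀ᵐ ω ∂P, c ≤ condLawZero P (sigmaAt Υ J) ω y := by
  let A : Set (Config Υ) := {ω | condLawZero P (sigmaAt Υ J) ω y < c}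
  have hA : MeasurableSet[sigmaAt Υ J] A :=
    measurableSet_lt (stronglyMeasurable_condExp (m := sigmaAt Υ J)).measurable measurable_const
  have hA' : MeasurableSet A := cylinderEvents_le_pi _ hA
  suffices h : P A = 0 by
    rw [ae_iff]; simpa only [not_le] using h
  by_contra hPA
  have hlt := hc A (cylinderEvents_mono (by
    intro v hv h0; exact hJ (h0 ▸ hv)) _ hA) hPA y
  have hpos : 0 < P.real A := ENNReal.toReal_pos hPA (measure_ne_top _ _)
  rw [measureReal_def, ProbabilityTheory.cond_apply hA', ENNReal.toReal_mul, ENNReal.toReal_inv,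
    ← measureReal_def, ← measureReal_def, lt_inv_mul_iff₀ hpos] at hlt
  have h1 : ∫ ω in A, condLawZero P (sigmaAt Υ J) ω y ∂P = P.real (A ∩ {ω | ω 0 = y}) := by
    have := setIntegral_condExp (μ := P) (m := sigmaAt Υ J) cylinderEvents_le_pi
      ((memLp_letter y 1).integrable le_rfl) hA
    rw [setIntegral_indicator (measurableSet_letter 0 y)] at this
    simpa [condLawZero] using! this
  have h2 : ∫ ω in A, condLawZero P (sigmaAt Υ J) ω y ∂P ≤ ∫ ω in A, c ∂P :=
    setIntegral_mono_on integrable_condExp.integrableOn (integrable_const _).integrableOn hA'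
      fun ω hω => le_of_lt hω
  simp only [setIntegral_const, smul_eq_mul] at h2
  linarith

variable [Fintype Υ] [DiscreteMeasurableSpace Υ]

theorem condInfo_mem_Icc {c : ℝ} (hc0 : 0 < c) (hc : LetterLowerBound P c) {J : Set Site}
    (hJ : (0 : Site) ∉ J) : ∀ᵐ ω ∂P, condInfo P J ω ∈ Set.Icc 0 (-Real.log c) := by
  filter_upwards [ae_all_iff.2 (le_condLawZero hc hJ), ae_all_iff.2 (condLawZero_le_one J)]
    with ω h₁ h₂
  have hpos := hc0.trans_le (h₁ (ω 0))
  exact ⟨neg_nonneg.2 (Real.log_nonpos hpos.le (h₂ _)),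
    neg_le_neg (Real.log_le_log hc0 (h₁ _))⟩

theorem abs_condInfo_le {c : ℝ} (hc0 : 0 < c) (hc : LetterLowerBound P c) {J : Set Site}
    (hJ : (0 : Site) ∉ J) : ∀ᵐ ω ∂P, |condInfo P J ω| ≤ -Real.log c := by
  filter_upwards [condInfo_mem_Icc hc0 hc hJ] with ω h
  rw [abs_of_nonneg h.1]
  exact h.2

theorem memLp_condInfo {c : ℝ} (hc0 : 0 < c) (hc : LetterLowerBound P c) {J : Set Site}
    (hJ : (0 : Site) ∉ J) (p : ENNReal) : MemLp (condInfo P J) p P :=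
  MemLp.of_bound (measurable_condInfo J).aestronglyMeasurable (-Real.log c)
    (abs_condInfo_le hc0 hc hJ)

theorem integrable_shannonEntropy_condLawZero (P : Measure (Config Υ)) [IsProbabilityMeasure P]
    (J : Set Site) :
    Integrable (fun ω => shannonEntropy (condLawZero P (sigmaAt Υ J) ω)) P := by
  refine integrable_finsetSum _ fun y _ => ?_
  refine (MemLp.of_bound (p := 1)
    (Real.continuous_negMulLog.measurable.comp (measurable_condLawZero J y)).aestronglyMeasurable
    1 ?_).integrable le_rfl
  filter_upwards [condLawZero_nonneg J y, condLawZero_le_one J y] with ω h₀ h₁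
  rw [Real.norm_eq_abs, Function.comp_apply, abs_of_nonneg (Real.negMulLog_nonneg h₀ h₁)]
  refine (Real.negMulLog_le_one_sub_self h₀).trans ?_
  linarith

/-- The logarithm is ℱ_J-measurable, so conditioning on ℱ_J turns the indicator of each letter into
its conditional probability. -/
theorem integral_condInfo {c : ℝ} (hc0 : 0 < c) (hc : LetterLowerBound P c) {J : Set Site}
    (hJ : (0 : Site) ∉ J) :
    ∫ ω, condInfo P J ω ∂P = ∫ ω, shannonEntropy (condLawZero P (sigmaAt Υ J) ω) ∂P := by
  let l (y : Υ) : Config Υ → ℝ := {ω : Config Υ | ω 0 = y}.indicator fun _ => (1 : ℝ)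
  let h (y : Υ) : Config Υ → ℝ := fun ω => -Real.log (condLawZero P (sigmaAt Υ J) ω y)
  have hl (y : Υ) : Integrable (l y) P := (memLp_letter y 1).integrable le_rfl
  have hbdd (y : Υ) : ∀ᵐ ω ∂P, ‖h y ω‖ ≤ -Real.log c := by
    filter_upwards [le_condLawZero hc hJ y, condLawZero_le_one J y] with ω h₁ h₂
    rw [Real.norm_eq_abs,
      abs_of_nonneg (neg_nonneg.2 (Real.log_nonpos (hc0.le.trans h₁) h₂))]
    exact neg_le_neg (Real.log_le_log hc0 h₁)
  have hsm (y : Υ) : StronglyMeasurable[sigmaAt Υ J] (h y) :=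
    ((stronglyMeasurable_condExp (m := sigmaAt Υ J)).measurable.log.neg).stronglyMeasurable
  have hlh (y : Υ) : Integrable (l y * h y) P :=
    (hl y).mul_bdd ((hsm y).mono cylinderEvents_le_pi).aestronglyMeasurable (hbdd y)
  have hch (y : Υ) : Integrable (P[l y | sigmaAt Υ J] * h y) P :=
    integrable_condExp.mul_bdd ((hsm y).mono cylinderEvents_le_pi).aestronglyMeasurable (hbdd y)
  calc ∫ ω, condInfo P J ω ∂P = ∫ ω, ∑ y, (l y * h y) ω ∂P := by
        congr 1; funext ω; exact condInfo_eq_sum P J ω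
    _ = ∑ y, ∫ ω, (l y * h y) ω ∂P := integral_finsetSum _ fun y _ => hlh y
    _ = ∑ y, ∫ ω, (P[l y | sigmaAt Υ J] * h y) ω ∂P := by
        congr 1; funext y
        rw [← integral_condExp (cylinderEvents_le_pi (Δ := J)) (f := l y * h y)]
        exact integral_congr_ae (condExp_mul_of_stronglyMeasurable_right (hsm y) (hlh y) (hl y))
    _ = ∫ ω, ∑ y, (P[l y | sigmaAt Υ J] * h y) ω ∂P :=
        (integral_finsetSum _ fun y _ => hch y).symm
    _ = _ := by
        congr 1; funext ω
        refine Finset.sum_congr rfl fun y _ => ?_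
        simp only [Real.negMulLog, Pi.mul_apply, h, condLawZero, l]
        ring

theorem exists_box_integral_condInfo_sub_lt (h01 : StrongZeroOneLaw P) {c : ℝ} (hc0 : 0 < c)
    (hc : LetterLowerBound P c) {ε : ℝ} (hε : 0 < ε) :
    ∃ n, ∀ J J' : Set Site, (0 : Site) ∉ J → (0 : Site) ∉ J' → J ∩ box n = J' ∩ box n →
      ∫ ω, |condInfo P J ω - condInfo P J' ω| ∂P < ε := by
  -- Summing c⁻¹ δ over the alphabet must stay below ε; the + 1 makes the inequality strict.
  set δ : ℝ := ε * c / (Fintype.card Υ + 1) with hδ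
  have hδ0 : 0 < δ := by positivity
  choose N hN using fun y : Υ => exists_box_condExp_lt h01 (memLp_letter (P := P) y 2)
    (ε := ENNReal.ofReal δ) (by simpa using hδ0)
  refine ⟨Finset.univ.sup N, fun J J' hJ hJ' hbox => ?_⟩
  let D (y : Υ) : Config Υ → ℝ := fun ω =>
    condLawZero P (sigmaAt Υ J) ω y - condLawZero P (sigmaAt Υ J') ω y
  have hDi (y : Υ) : Integrable (D y) P := integrable_condExp.sub integrable_condExp
  have hD (y : Υ) : ∫ ω, |D y ω| ∂P < δ := by
    have hb : J ∩ box (N y) = J' ∩ box (N y) := by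
      have hsub : (box (N y) : Set Site) ⊆ box (Finset.univ.sup N) :=
        Finset.coe_subset.2 (box_mono (Finset.le_sup (Finset.mem_univ y)))
      rw [← Set.inter_eq_self_of_subset_right hsub, ← Set.inter_assoc, ← Set.inter_assoc, hbox]
    have h := hN y J J' hb
    change eLpNorm (D y) 1 P < _ at h
    rw [eLpNorm_one_eq_lintegral_enorm, ← ofReal_integral_norm_eq_lintegral_enorm (hDi y)] at h
    exact (ENNReal.ofReal_lt_ofReal_iff hδ0).1 h
  have hle : ∀ᵐ ω ∂P, |condInfo P J ω - condInfo P J' ω| ≤ ∑ y, c⁻¹ * |D y ω| := by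
    filter_upwards [ae_all_iff.2 (le_condLawZero hc hJ), ae_all_iff.2 (le_condLawZero hc hJ')]
      with ω h₁ h₂
    calc |condInfo P J ω - condInfo P J' ω| ≤ c⁻¹ * |D (ω 0) ω| := by
          rw [condInfo, condInfo, neg_sub_neg, abs_sub_comm]
          exact Real.abs_log_sub_log_le_of_le hc0 (h₁ _) (h₂ _)
      _ ≤ _ := Finset.single_le_sum (f := fun y => c⁻¹ * |D y ω|)
          (fun y _ => by positivity) (Finset.mem_univ (ω 0))
  have hint : Integrable (fun ω => ∑ y, c⁻¹ * |D y ω|) P :=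
    integrable_finsetSum _ fun y _ => (hDi y).abs.const_mul _
  calc ∫ ω, |condInfo P J ω - condInfo P J' ω| ∂P ≤ ∫ ω, ∑ y, c⁻¹ * |D y ω| ∂P :=
        integral_mono_ae ((((memLp_condInfo hc0 hc hJ 1).sub
          (memLp_condInfo hc0 hc hJ' 1)).integrable le_rfl).abs) hint hle
    _ = ∑ y, c⁻¹ * ∫ ω, |D y ω| ∂P := by
        rw [integral_finsetSum _ fun y _ => (hDi y).abs.const_mul _]
        simp_rw [integral_const_mul]
    _ ≤ ∑ y : Υ, c⁻¹ * δ := by gcongr with y; exact (hD y).le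
    _ = ε * (Fintype.card Υ / (Fintype.card Υ + 1)) := by
        rw [Finset.sum_const, Finset.card_univ, nsmul_eq_mul, hδ]
        field_simp
    _ < ε * 1 := by
        gcongr
        rw [div_lt_one (by positivity)]
        linarith
    _ = ε := mul_one ε

end RandomField

/-! ### Information of finite windows. -/

namespace RandomField

theorem setOf_eq_on_eq_preimage {Υ : Type*} (K : Set Site) (ω : Config Υ) :
    {η : Config Υ | ∀ v ∈ K, η v = ω v} =
      (K.domRestrict : Config Υ → (K → Υ)) ⁻¹' {(K.domRestrict ω : K → Υ)} := by
  ext η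
  simp [funext_iff, Set.domRestrict]

variable {Υ : Type*} [MeasurableSpace Υ]

theorem sigmaAt_eq_comap_domRestrict (K : Set Site) :
    sigmaAt Υ K = MeasurableSpace.comap (K.domRestrict : Config Υ → (K → Υ)) inferInstance := by
  apply le_antisymm
  · refine iSup₂_le fun v hv => ?_
    rw [← measurable_iff_comap_le]
    exact (measurable_pi_apply (X := fun _ : K => Υ) ⟨v, hv⟩).comp
      (comap_measurable (K.domRestrict : Config Υ → (K → Υ)))
  · rw [← measurable_iff_comap_le]
    exact measurable_restrict_cylinderEvents K

theorem measurable_domRestrict (K : Set Site) :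
    Measurable (K.domRestrict : Config Υ → (K → Υ)) :=
  (measurable_restrict_cylinderEvents K).mono cylinderEvents_le_pi le_rfl

/-- There are finitely many patterns, so the null ones can be discarded together. This keeps the
convention `Real.log 0 = 0` out of the chain rule. -/
theorem ae_measure_real_eq_on_pos [Fintype Υ] (P : Measure (Config Υ)) [IsProbabilityMeasure P]
    {K : Set Site} (hK : K.Finite) : ∀ᵐ ω ∂P, 0 < P.real {η | ∀ v ∈ K, η v = ω v} := by
  have := hK.to_subtype
  have h : ∀ᵐ ω ∂P, ∀ x : K → Υ,
      ω ∈ (K.domRestrict ⁻¹' {x} : Set (Config Υ)) →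
        0 < P.real (K.domRestrict ⁻¹' {x} : Set (Config Υ)) := by
    refine ae_all_iff.2 fun x => ?_
    by_cases hx : P (K.domRestrict ⁻¹' {x} : Set (Config Υ)) = 0
    · filter_upwards [measure_eq_zero_iff_ae_notMem.1 hx] with ω hω h using absurd h hω
    · exact ae_of_all _ fun ω _ => ENNReal.toReal_pos hx (measure_ne_top _ _)
  filter_upwards [h] with ω hω
  rw [setOf_eq_on_eq_preimage]
  exact hω _ rfl

theorem information_image_add_right [DiscreteMeasurableSpace Υ] {P : Measure (Config Υ)} (hstat : Stationary P)
    {K : Set Site} (u : Site) (ω : Config Υ) :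
    information P ((fun v => v + u) '' K) ω = information P K (shift u ω) := by
  have hset : {η : Config Υ | ∀ v ∈ (fun v => v + u) '' K, η v = ω v}
      = shift u ⁻¹' {η | ∀ v ∈ K, η v = shift u ω v} := by
    ext η
    simp only [Set.forall_mem_image, Set.mem_preimage, Set.mem_ofPred_eq, shift]
  have hmeas : MeasurableSet {η : Config Υ | ∀ v ∈ K, η v = shift u ω v} := by
    simp only [Set.ofPred_forall]
    exact MeasurableSet.biInter K.to_countable fun v _ => measurableSet_letter v _
  rw [information, information, hset,
    (hstat u).measureReal_preimage hmeas.nullMeasurableSet]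

variable [Fintype Υ] [DiscreteMeasurableSpace Υ]

theorem measurable_of_domRestrict {K : Set Site} (hK : K.Finite) (g : (K → Υ) → ℝ) :
    Measurable fun ω : Config Υ => g (K.domRestrict ω) := by
  have := hK.to_subtype
  exact (measurable_of_countable g).comp (measurable_domRestrict K)

theorem integral_comp_domRestrict_eq_sum {K : Set Site} (hK : K.Finite) (μ : Measure (Config Υ))
    [IsFiniteMeasure μ] [Fintype (K → Υ)] (g : (K → Υ) → ℝ) :
    ∫ ω, g (K.domRestrict ω) ∂μ = ∑ x, μ.real (K.domRestrict ⁻¹' {x}) * g x := by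
  have := hK.to_subtype
  have : IsFiniteMeasure (μ.map (K.domRestrict : Config Υ → (K → Υ))) := inferInstance
  rw [← integral_map (measurable_domRestrict K).aemeasurable
    (measurable_of_countable g).aestronglyMeasurable, integral_fintype .of_finite]
  refine Finset.sum_congr rfl fun x _ => ?_
  rw [map_measureReal_apply (measurable_domRestrict K) (measurableSet_singleton x), smul_eq_mul]

theorem condLawZero_ae_eq_div (P : Measure (Config Υ)) [IsProbabilityMeasure P] {K : Set Site}
    (hK : K.Finite) (y : Υ) :
    (fun ω => P.real ({η | η 0 = y} ∩ {η | ∀ v ∈ K, η v = ω v}) /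
      P.real {η | ∀ v ∈ K, η v = ω v}) =ᵐ[P] fun ω => condLawZero P (sigmaAt Υ K) ω y := by
  classical
  have := hK.fintype
  let π : Config Υ → (K → Υ) := K.domRestrict
  let g : (K → Υ) → ℝ := fun x => P.real ({η | η 0 = y} ∩ π ⁻¹' {x}) / P.real (π ⁻¹' {x})
  have hπ : Measurable π := measurable_domRestrict K
  have hg : (fun ω => P.real ({η : Config Υ | η 0 = y} ∩ {η | ∀ v ∈ K, η v = ω v}) /
      P.real {η | ∀ v ∈ K, η v = ω v}) = fun ω => g (π ω) := by
    funext ω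
    simp only [setOf_eq_on_eq_preimage, g, π]
  have hint : Integrable (fun ω => g (π ω)) P := by
    have hgi : Integrable g (P.map π) := .of_finite
    exact hgi.comp_measurable hπ
  rw [hg]
  refine ae_eq_condExp_of_forall_setIntegral_eq cylinderEvents_le_pi
    ((memLp_letter y 1).integrable le_rfl) (fun s _ _ => hint.integrableOn) (fun s hs _ => ?_) ?_
  · have hs' := cylinderEvents_le_pi _ hs
    rw [setIntegral_indicator (measurableSet_letter 0 y)]
    replace hs : MeasurableSet[sigmaAt Υ K] s := hs
    rw [sigmaAt_eq_comap_domRestrict] at hs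
    obtain ⟨B, -, rfl⟩ := hs
    change MeasurableSet (π ⁻¹' B) at hs'
    change ∫ ω in π ⁻¹' B, g (π ω) ∂P = ∫ ω in π ⁻¹' B ∩ _, (1 : ℝ) ∂P
    have h₁ := integral_comp_domRestrict_eq_sum hK P (B.indicator g)
    have h₂ := integral_comp_domRestrict_eq_sum hK (P.restrict {η | η 0 = y}) (B.indicator 1)
    have e₁ : ∫ ω in π ⁻¹' B, g (π ω) ∂P = ∫ ω, B.indicator g (π ω) ∂P := by
      rw [← integral_indicator hs']
      rfl
    have e₂ : ∫ ω in π ⁻¹' B ∩ {η | η 0 = y}, (1 : ℝ) ∂P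
        = ∫ ω, B.indicator 1 (π ω) ∂(P.restrict {η | η 0 = y}) := by
      rw [← Measure.restrict_restrict hs', ← integral_indicator hs']
      rfl
    rw [e₁, e₂]
    refine h₁.trans (Eq.trans ?_ h₂.symm)
    refine Finset.sum_congr rfl fun x _ => ?_
    rw [measureReal_restrict_apply (hπ (measurableSet_singleton x)), Set.inter_comm]
    by_cases hx : x ∈ B
    · simp only [Set.indicator_of_mem hx, g, Pi.one_apply, mul_one]
      -- On a null pattern the quotient has the default value 0, and the joint probability vanishes
      -- too.
      by_cases h0 : P.real (π ⁻¹' {x}) = 0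
      · have : P.real ({η : Config Υ | η 0 = y} ∩ π ⁻¹' {x}) = 0 :=
          le_antisymm (h0 ▸ measureReal_mono Set.inter_subset_right) measureReal_nonneg
        simp only [π] at this ⊢
        simp [this]
      · exact mul_div_cancel₀ _ h0
    · simp [Set.indicator_of_notMem hx]
  · refine StronglyMeasurable.aestronglyMeasurable (Measurable.stronglyMeasurable ?_)
    exact (measurable_of_countable g).comp (measurable_restrict_cylinderEvents K)

theorem information_insert_sub_ae_eq_condInfo (P : Measure (Config Υ)) [IsProbabilityMeasure P]
    {K : Set Site} (hK : K.Finite) :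
    (fun ω => information P (insert 0 K) ω - information P K ω) =ᵐ[P] condInfo P K := by
  filter_upwards [ae_all_iff.2 (condLawZero_ae_eq_div P hK), ae_measure_real_eq_on_pos P hK,
    ae_measure_real_eq_on_pos P (hK.insert 0)] with ω h₁ h₂ h₃
  have hset : {η : Config Υ | ∀ v ∈ insert 0 K, η v = ω v}
      = {η | η 0 = ω 0} ∩ {η | ∀ v ∈ K, η v = ω v} := by
    ext η
    simp
  rw [hset] at h₃
  rw [condInfo, ← h₁ (ω 0), information, information, hset, Real.log_div h₃.ne' h₂.ne']
  ring

theorem memLp_information (P : Measure (Config Υ)) [IsProbabilityMeasure P] {K : Set Site}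
    (hK : K.Finite) (p : ENNReal) : MemLp (information P K) p P := by
  classical
  have := hK.fintype
  let g : (K → Υ) → ℝ := fun x => -Real.log (P.real (K.domRestrict ⁻¹' {x}))
  have hg : information P K = fun ω => g (K.domRestrict ω) := by
    funext ω
    simp only [information, setOf_eq_on_eq_preimage, g]
  rw [hg]
  exact MemLp.of_bound (measurable_of_domRestrict hK g).aestronglyMeasurable (∑ x, ‖g x‖)
    (ae_of_all _ fun ω => Finset.single_le_sum (f := fun x => ‖g x‖)
      (fun _ _ => norm_nonneg _) (Finset.mem_univ _))

end RandomField

/-! ### Geometry of the lattice line and the chain rule. -/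

namespace RandomField

section Lattice

variable {σ : Site ≃+ Site} {slope a t : ℝ} {U : Set ℤ}

/-- The site of the lattice approximation over the abscissa `z`. -/
noncomputable def latticeSite (σ : Site ≃+ Site) (slope a : ℝ) (z : ℤ) : Site :=
  σ (z, ⌊slope * z + a⌋)

theorem mem_latticeApprox {v : Site} : v ∈ latticeApprox σ slope a U ↔
    (σ.symm v).1 ∈ U ∧ ⌊slope * (σ.symm v).1 + a⌋ = (σ.symm v).2 := by
  constructor
  · rintro ⟨z, hz, rfl⟩
    simp [hz]
  · rintro ⟨h₁, h₂⟩
    refine ⟨(σ.symm v).1, h₁, ?_⟩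
    simp only [h₂]
    exact σ.apply_symm_apply v

theorem zero_notMem_latticeApprox (hU : (0 : ℤ) ∉ U) :
    (0 : Site) ∉ latticeApprox σ slope a U := by
  rw [mem_latticeApprox]
  simp [hU]

/-- Intercepts in [0, 1) are exactly those whose line passes through the origin over abscissa 0. -/
theorem latticeApprox_insert_zero (ht₀ : 0 ≤ t) (ht₁ : t < 1) :
    latticeApprox σ slope t (insert 0 U) = insert 0 (latticeApprox σ slope t U) := by
  have : ⌊t⌋ = 0 := Int.floor_eq_zero_iff.2 ⟨ht₀, ht₁⟩
  rw [latticeApprox, Set.image_insert_eq]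
  simp only [Int.cast_zero, mul_zero, zero_add, this]
  rw [show ((0 : ℤ), (0 : ℤ)) = (0 : Site) from rfl, map_zero, latticeApprox]

/-- λ(j + k) + a = λj + {λk + a} + ⌊λk + a⌋: recentring at abscissa k rotates the intercept by λk.
This is the source of the circle rotation. -/
theorem latticeApprox_image_add (k : ℤ) :
    latticeApprox σ slope a ((fun j => j + k) '' U) =
      (fun v => v + latticeSite σ slope a k) ''
        latticeApprox σ slope (Int.fract (slope * k + a)) U := by
  simp only [latticeApprox, Set.image_image, latticeSite]
  refine Set.image_congr fun j _ => ?_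
  rw [← map_add, Prod.mk_add_mk, ← Int.floor_add_intCast]
  congr 3
  push_cast [Int.fract]
  ring

theorem latticeApprox_finite (hU : U.Finite) : (latticeApprox σ slope a U).Finite :=
  hU.image _

end Lattice

variable {Υ : Type*} [MeasurableSpace Υ] [Fintype Υ] [DiscreteMeasurableSpace Υ]

theorem information_Ico_succ_ae_eq {P : Measure (Config Υ)} [IsProbabilityMeasure P]
    (hstat : Stationary P) (σ : Site ≃+ Site) (slope a : ℝ) (k : ℕ) :
    (fun ω => information P (latticeApprox σ slope a (Set.Ico 0 ((k + 1 : ℕ) : ℤ))) ω) =ᵐ[P]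
      fun ω => information P (latticeApprox σ slope a (Set.Ico 0 (k : ℤ))) ω +
        condInfo P (latticeApprox σ slope (Int.fract (slope * k + a)) (Set.Ico (-(k : ℤ)) 0))
          (shift (latticeSite σ slope a k) ω) := by
  have e₁ : Set.Ico (0 : ℤ) k = (fun j => j + (k : ℤ)) '' Set.Ico (-(k : ℤ)) 0 := by
    simp
  have e₂ : Set.Ico (0 : ℤ) ((k + 1 : ℕ) : ℤ)
      = (fun j => j + (k : ℤ)) '' insert 0 (Set.Ico (-(k : ℤ)) 0) := by
    rw [Set.image_insert_eq, ← e₁]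
    ext j
    simp only [Set.mem_Ico, Set.mem_insert_iff]
    omega
  have hfin : (latticeApprox σ slope (Int.fract (slope * k + a)) (Set.Ico (-(k : ℤ)) 0)).Finite :=
    latticeApprox_finite (Set.finite_Ico _ _)
  have h := (hstat (latticeSite σ slope a k)).quasiMeasurePreserving.ae
    (information_insert_sub_ae_eq_condInfo P hfin)
  filter_upwards [h] with ω hω
  rw [e₁, e₂, latticeApprox_image_add, latticeApprox_image_add, Int.cast_natCast,
    information_image_add_right hstat, information_image_add_right hstat, ← hω,
    latticeApprox_insert_zero (Int.fract_nonneg _) (Int.fract_lt_one _)]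
  ring

/-- The chain rule for the information along the lattice approximation of a line. -/
theorem information_ae_eq_sum {P : Measure (Config Υ)} [IsProbabilityMeasure P]
    (hstat : Stationary P) (σ : Site ≃+ Site) (slope a : ℝ) (n : ℕ) :
    (fun ω => information P (latticeApprox σ slope a (Set.Ico 0 (n : ℤ))) ω) =ᵐ[P]
      fun ω => ∑ k ∈ Finset.range n,
        condInfo P (latticeApprox σ slope (Int.fract (slope * k + a)) (Set.Ico (-(k : ℤ)) 0))
          (shift (latticeSite σ slope a k) ω) := by
  induction n with
  | zero =>
    refine ae_of_all _ fun ω => ?_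
    simp [latticeApprox, information]
  | succ n ih =>
    filter_upwards [ih, information_Ico_succ_ae_eq hstat σ slope a n] with ω h₁ h₂
    rw [h₂, h₁, Finset.sum_range_succ]

end RandomField

/-! ### Weyl equidistribution on the circle. -/

section Weyl

instance UnitAddCircle.isProbabilityMeasure_volume :
    IsProbabilityMeasure (volume : Measure UnitAddCircle) :=
  ⟨UnitAddCircle.measure_univ⟩

theorem fourier_coe_ne_one {α : ℝ} (hα : Irrational α) {m : ℤ} (hm : m ≠ 0) :
    fourier m (α : UnitAddCircle) ≠ 1 := by
  intro h
  rw [fourier_coe_apply, Complex.exp_eq_one_iff] at h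
  obtain ⟨n, hn⟩ := h
  have h2 : (m : ℂ) * α = n := by
    have hne := Complex.two_pi_I_ne_zero
    apply mul_left_cancel₀ hne
    rw [← mul_comm (n : ℂ), ← hn]
    push_cast
    ring
  have h3 : (m : ℝ) * α = n := by exact_mod_cast h2
  exact (hα.intCast_mul hm).ne_int n h3

theorem integral_fourier_of_ne_zero {m : ℤ} (hm : m ≠ 0) :
    ∫ x : UnitAddCircle, fourier m x = 0 := by
  have h := orthonormal_fourier (T := 1)
  have hz := (orthonormal_iff_ite.1 h) 0 m
  rw [if_neg hm.symm] at hz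
  rw [ContinuousMap.inner_toLp] at hz
  simpa [AddCircle.volume_eq_smul_haarAddCircle] using hz

/-- For m ≠ 0 the sums are geometric with ratio r ≠ 1, hence bounded by 2 / ‖r - 1‖. -/
theorem tendsto_average_fourier {α : ℝ} (hα : Irrational α) (x : UnitAddCircle) (m : ℤ) :
    Tendsto (fun n : ℕ => (n : ℂ)⁻¹ * ∑ k ∈ Finset.range n,
      fourier m (x + k • (α : UnitAddCircle))) atTop (𝓝 (∫ x : UnitAddCircle, fourier m x)) := by
  by_cases hm : m = 0
  · subst hm
    simp only [fourier_zero, Finset.sum_const, Finset.card_range, nsmul_eq_mul, mul_one]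
    have : ∫ x : UnitAddCircle, (1 : ℂ) = 1 := by simp
    rw [this]
    refine tendsto_const_nhds.congr' ?_
    filter_upwards [eventually_gt_atTop 0] with n hn
    rw [inv_mul_cancel₀]
    exact_mod_cast hn.ne'
  · rw [integral_fourier_of_ne_zero hm]
    set r : ℂ := fourier m (α : UnitAddCircle) with hr
    have hr1 : r ≠ 1 := fourier_coe_ne_one hα hm
    have hrn : ‖r‖ = 1 := by rw [hr, fourier_apply]; exact Circle.norm_coe _
    have hpow (k : ℕ) : fourier m (x + k • (α : UnitAddCircle)) = fourier m x * r ^ k := by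
      induction k with
      | zero => simp
      | succ k ih =>
        rw [succ_nsmul, ← add_assoc, fourier_apply, smul_add, AddCircle.toCircle_add,
          Circle.coe_mul, ← fourier_apply, ← fourier_apply, ih, pow_succ, mul_assoc]
    simp only [hpow, ← Finset.mul_sum, geom_sum_eq hr1]
    have hx : ‖fourier m x‖ = 1 := by rw [fourier_apply]; exact Circle.norm_coe _
    refine squeeze_zero_norm (a := fun n : ℕ => (n : ℝ)⁻¹ * (2 / ‖r - 1‖)) (fun n => ?_) ?_
    · rw [norm_mul, norm_mul, norm_inv, Complex.norm_natCast, norm_div, hx, one_mul]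
      gcongr
      refine (norm_sub_le _ _).trans ?_
      simp [hrn]
      norm_num
    · have := (tendsto_inv_atTop_nhds_zero_nat (𝕜 := ℝ)).mul_const (2 / ‖r - 1‖)
      simpa using this

/-- **Weyl's equidistribution theorem** for complex continuous functions. -/
theorem tendsto_average_of_irrational {α : ℝ} (hα : Irrational α) (x : UnitAddCircle)
    (f : C(UnitAddCircle, ℂ)) :
    Tendsto (fun n : ℕ => (n : ℂ)⁻¹ * ∑ k ∈ Finset.range n, f (x + k • (α : UnitAddCircle)))
      atTop (𝓝 (∫ x : UnitAddCircle, f x)) := by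
  have hint (f : C(UnitAddCircle, ℂ)) : Integrable f (volume : Measure UnitAddCircle) :=
    f.continuous.integrable_of_hasCompactSupport (HasCompactSupport.of_compactSpace f)
  have hspan : ∀ g ∈ Submodule.span ℂ (Set.range (@fourier (1 : ℝ))),
      Tendsto (fun n : ℕ => (n : ℂ)⁻¹ * ∑ k ∈ Finset.range n, g (x + k • (α : UnitAddCircle)))
        atTop (𝓝 (∫ x : UnitAddCircle, g x)) := by
    intro g hg
    induction hg using Submodule.span_induction with
    | mem g hg =>
      obtain ⟨m, rfl⟩ := hg
      exact tendsto_average_fourier hα x m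
    | zero => simp
    | add g h _ _ hg hh =>
      simp only [ContinuousMap.add_apply, Finset.sum_add_distrib, mul_add]
      rw [integral_add (hint g) (hint h)]
      exact hg.add hh
    | smul c g _ hg =>
      simp only [ContinuousMap.smul_apply, smul_eq_mul, ← Finset.mul_sum, integral_const_mul]
      refine (hg.const_mul c).congr fun n => by ring
  rw [Metric.tendsto_atTop]
  intro ε hε
  -- Trigonometric polynomials are uniformly dense, so an ε/3 argument extends the limit.
  have hf : f ∈ closure (Submodule.span ℂ (Set.range (@fourier (1 : ℝ))) :
      Set C(UnitAddCircle, ℂ)) := by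
    rw [← Submodule.topologicalClosure_coe, span_fourier_closure_eq_top]
    trivial
  obtain ⟨g, hg, hfg⟩ := Metric.mem_closure_iff.1 hf (ε / 3) (by positivity)
  obtain ⟨N, hN⟩ := Metric.tendsto_atTop.1 (hspan g hg) (ε / 3) (by positivity)
  refine ⟨N, fun n hn => ?_⟩
  have hpt (y : UnitAddCircle) : ‖f y - g y‖ ≤ ε / 3 := by
    rw [← dist_eq_norm]
    exact (ContinuousMap.dist_apply_le_dist y).trans hfg.le
  have h₁ : dist ((n : ℂ)⁻¹ * ∑ k ∈ Finset.range n, f (x + k • (α : UnitAddCircle)))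
      ((n : ℂ)⁻¹ * ∑ k ∈ Finset.range n, g (x + k • (α : UnitAddCircle))) ≤ ε / 3 := by
    rw [dist_eq_norm, ← mul_sub, ← Finset.sum_sub_distrib, norm_mul, norm_inv,
      Complex.norm_natCast]
    have h := norm_sum_le_of_le (Finset.range n) fun k _ => hpt (x + k • (α : UnitAddCircle))
    rw [Finset.sum_const, Finset.card_range, nsmul_eq_mul] at h
    calc _ ≤ (n : ℝ)⁻¹ * (n * (ε / 3)) := by gcongr
      _ ≤ 1 * (ε / 3) := by
        rw [← mul_assoc]
        gcongr
        exact inv_mul_le_one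
      _ = _ := one_mul _
  have h₂ : dist (∫ x : UnitAddCircle, g x) (∫ x : UnitAddCircle, f x) ≤ ε / 3 := by
    rw [dist_comm, dist_eq_norm, ← integral_sub (hint f) (hint g)]
    have := norm_integral_le_of_norm_le_const (μ := (volume : Measure UnitAddCircle))
      (ae_of_all _ hpt)
    simpa using this
  have h₃ := hN n hn
  calc _ ≤ _ := dist_triangle4 _ _ _ _
    _ < ε / 3 + ε / 3 + ε / 3 := add_lt_add_of_lt_of_le (add_lt_add_of_le_of_lt h₁ h₃) h₂
    _ = ε := by ring

/-- **Weyl's equidistribution theorem** for real continuous functions. -/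
theorem tendsto_average_of_irrational_of_continuous {α : ℝ} (hα : Irrational α) (x : UnitAddCircle)
    {f : UnitAddCircle → ℝ} (hf : Continuous f) :
    Tendsto (fun n : ℕ => (n : ℝ)⁻¹ * ∑ k ∈ Finset.range n, f (x + k • (α : UnitAddCircle)))
      atTop (𝓝 (∫ x : UnitAddCircle, f x)) := by
  have h := tendsto_average_of_irrational hα x
    ⟨fun y => (f y : ℂ), Complex.continuous_ofReal.comp hf⟩
  simp only [ContinuousMap.coe_mk] at h
  rw [integral_complex_ofReal] at h
  have h' := (Complex.continuous_re.tendsto _).comp h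
  rw [Complex.ofReal_re] at h'
  refine h'.congr fun n => ?_
  rw [Function.comp_apply, ← Complex.ofReal_natCast, ← Complex.ofReal_inv, ← Complex.ofReal_sum,
    ← Complex.ofReal_mul, Complex.ofReal_re]

/-- **Weyl's equidistribution theorem** for bounded functions with finitely many
discontinuities. -/
theorem tendsto_average_of_irrational_of_continuousOn {α : ℝ} (hα : Irrational α)
    (x : UnitAddCircle) {D : Set UnitAddCircle} (hD : D.Finite) (hne : D.Nonempty)
    {G : UnitAddCircle → ℝ} {M : ℝ} (hM : ∀ y, |G y| ≤ M) (hG : ContinuousOn G Dᶜ) :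
    Tendsto (fun n : ℕ => (n : ℝ)⁻¹ * ∑ k ∈ Finset.range n, G (x + k • (α : UnitAddCircle)))
      atTop (𝓝 (∫ x : UnitAddCircle, G x)) := by
  have hM0 : 0 ≤ M := (abs_nonneg _).trans (hM 0)
  have hnull : volume D = 0 := by
    refine (measure_null_iff_singleton hD.countable).2 fun y _ => ?_
    have := AddCircle.volume_closedBall (T := 1) (x := y) 0
    simpa using this
  have hae : ∀ᵐ y : UnitAddCircle, y ∉ D := measure_eq_zero_iff_ae_notMem.1 hnull
  -- Continuous cut-offs vanishing on D and tending to 1 off D. Both G ψ and 1 - ψ are continuous,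
  -- and M (1 - ψ) bounds what is cut away.
  let ψ (m : ℕ) (y : UnitAddCircle) : ℝ := min 1 (m * Metric.infDist y D)
  have hψ0 (m y) : 0 ≤ ψ m y := 
    le_min zero_le_one (mul_nonneg (Nat.cast_nonneg m) Metric.infDist_nonneg)
  have hψ1 (m y) : ψ m y ≤ 1 := min_le_left _ _
  have hψc (m) : Continuous (ψ m) :=
    continuous_const.min (continuous_const.mul (Metric.continuous_infDist_pt D))
  have hGψ (m y) : |G y * ψ m y| ≤ M * ψ m y := by
    rw [abs_mul, abs_of_nonneg (hψ0 m y)]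
    exact mul_le_mul_of_nonneg_right (hM y) (hψ0 m y)
  have hGψc (m) : Continuous fun y => G y * ψ m y := by
    rw [continuous_iff_continuousAt]
    intro y
    by_cases hy : y ∈ D
    · have h0 : ψ m y = 0 := by simp [ψ, Metric.infDist_zero_of_mem hy]
      have hlim : Tendsto (fun z => M * ψ m z) (𝓝 y) (𝓝 0) := by
        have := ((hψc m).const_mul M).tendsto y
        simpa [h0] using this
      rw [ContinuousAt, h0, mul_zero]
      exact squeeze_zero_norm (hGψ m) hlim
    · exact (hG.continuousAt (hD.isClosed.isOpen_compl.mem_nhds hy)).mul (hψc m).continuousAt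
  have hψlim : ∀ᵐ y : UnitAddCircle, Tendsto (fun m => ψ m y) atTop (𝓝 1) := by
    filter_upwards [hae] with y hy
    -- `Metric.infDist` to the empty set is 0, hence the assumption that D is nonempty.
    have hpos : 0 < Metric.infDist y D := (hD.isClosed.notMem_iff_infDist_pos hne).1 hy
    refine tendsto_const_nhds.congr' ?_
    filter_upwards [(tendsto_natCast_atTop_atTop.atTop_mul_const hpos).eventually_ge_atTop 1]
      with m hm
    exact (min_eq_left hm).symm
  have hI₁ : Tendsto (fun m => ∫ y, G y * ψ m y) atTop (𝓝 (∫ y, G y)) := by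
    refine tendsto_integral_of_dominated_convergence (fun _ => M)
      (fun m => (hGψc m).aestronglyMeasurable) (integrable_const _) (fun m => ae_of_all _ fun y =>
        (hGψ m y).trans (mul_le_of_le_one_right hM0 (hψ1 m y))) ?_
    filter_upwards [hψlim] with y hy
    simpa using hy.const_mul (G y)
  have hI₂ : Tendsto (fun m => ∫ y, (1 - ψ m y)) atTop (𝓝 0) := by
    have : Tendsto (fun m => ∫ y, (1 - ψ m y)) atTop (𝓝 (∫ _ : UnitAddCircle, (0 : ℝ))) := by
      refine tendsto_integral_of_dominated_convergence (fun _ => 1)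
        (fun m => (continuous_const.sub (hψc m)).aestronglyMeasurable) (integrable_const _)
        (fun m => ae_of_all _ fun y => ?_) ?_
      · rw [Real.norm_eq_abs, abs_of_nonneg (sub_nonneg.2 (hψ1 m y))]
        linarith [hψ0 m y]
      · filter_upwards [hψlim] with y hy
        simpa using hy.const_sub 1
    simpa using this
  rw [Metric.tendsto_atTop]
  intro ε hε
  -- With δ = ε / (M + 4), the total error is at most Mδ + δ + δ < ε.
  have hδ : 0 < ε / (M + 4) := by positivity
  obtain ⟨m, hm₁, hm₂⟩ := ((Metric.tendsto_nhds.1 hI₁ _ hδ).and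
    (hI₂.eventually (gt_mem_nhds hδ))).exists
  have hA₁ := tendsto_average_of_irrational_of_continuous hα x (hGψc m)
  have hA₂ := tendsto_average_of_irrational_of_continuous hα x (f := fun y => 1 - ψ m y)
    (continuous_const.sub (hψc m))
  obtain ⟨N, hN⟩ := eventually_atTop.1 ((Metric.tendsto_nhds.1 hA₁ _ hδ).and
    (hA₂.eventually (gt_mem_nhds hm₂)))
  refine ⟨N, fun n hn => ?_⟩
  obtain ⟨h₁, h₂⟩ := hN n hn
  have h₃ : |(n : ℝ)⁻¹ * ∑ k ∈ Finset.range n, G (x + k • (α : UnitAddCircle)) -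
      (n : ℝ)⁻¹ * ∑ k ∈ Finset.range n,
        G (x + k • (α : UnitAddCircle)) * ψ m (x + k • (α : UnitAddCircle))| ≤
      M * ((n : ℝ)⁻¹ * ∑ k ∈ Finset.range n, (1 - ψ m (x + k • (α : UnitAddCircle)))) := by
    rw [← mul_sub, ← Finset.sum_sub_distrib, abs_mul, abs_of_nonneg (by positivity),
      mul_left_comm, Finset.mul_sum (a := M)]
    gcongr
    refine (Finset.abs_sum_le_sum_abs _ _).trans (Finset.sum_le_sum fun k _ => ?_)
    rw [← mul_one_sub, abs_mul, abs_of_nonneg (sub_nonneg.2 (hψ1 _ _))]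
    exact mul_le_mul_of_nonneg_right (hM _) (sub_nonneg.2 (hψ1 _ _))
  have h₄ := mul_le_mul_of_nonneg_left h₂.le hM0
  rw [Real.dist_eq] at h₁ hm₁ ⊢
  have h₅ : ε = M * (ε / (M + 4)) + 4 * (ε / (M + 4)) := by field_simp
  rw [abs_lt] at h₁ hm₁ ⊢
  rw [abs_le] at h₃
  constructor <;> linarith [h₁.1, h₁.2, hm₁.1, hm₁.2, h₃.1, h₃.2]

end Weyl

/-! ### A second-moment law of large numbers. -/

section Average

variable {Ω : Type*} {m0 : MeasurableSpace Ω} {μ : Measure Ω} [IsProbabilityMeasure μ]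

/-- Integrate |f| ≤ δ/2 + f²/(2δ). -/
theorem integral_abs_le_of_integral_sq_le {f : Ω → ℝ} (hf : MemLp f 2 μ) {δ : ℝ} (hδ : 0 < δ)
    (h : ∫ ω, f ω ^ 2 ∂μ ≤ δ ^ 2) : ∫ ω, |f ω| ∂μ ≤ δ := by
  have hle (ω : Ω) : |f ω| ≤ δ / 2 + (2 * δ)⁻¹ * f ω ^ 2 := by
    have h₁ : 0 ≤ (2 * δ)⁻¹ * (|f ω| - δ) ^ 2 := by positivity
    have h₂ : (2 * δ)⁻¹ * (|f ω| - δ) ^ 2 = (2 * δ)⁻¹ * f ω ^ 2 - |f ω| + δ / 2 := by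
      rw [sub_sq, sq_abs]
      field_simp
    linarith
  calc ∫ ω, |f ω| ∂μ ≤ ∫ ω, (δ / 2 + (2 * δ)⁻¹ * f ω ^ 2) ∂μ :=
        integral_mono (hf.integrable one_le_two).abs
          ((integrable_const _).add (hf.integrable_sq.const_mul _)) hle
    _ = δ / 2 + (2 * δ)⁻¹ * ∫ ω, f ω ^ 2 ∂μ := by
        rw [integral_add (integrable_const _) (hf.integrable_sq.const_mul _), integral_const_mul]
        simp
    _ ≤ δ / 2 + (2 * δ)⁻¹ * δ ^ 2 := by gcongr
    _ = δ := by field_simp; norm_num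

/-- A law of large numbers for bounded sequences with asymptotically vanishing correlations. -/
theorem tendsto_integral_abs_average {X : ℕ → Ω → ℝ} {M : ℝ}
    (hX : ∀ k, AEStronglyMeasurable (X k) μ) (hM : ∀ k, ∀ᵐ ω ∂μ, |X k ω| ≤ M)
    (hcov : ∀ ε : ℝ, 0 < ε → ∃ R : ℕ, ∀ j k, j + R ≤ k → |∫ ω, X j ω * X k ω ∂μ| ≤ ε) :
    Tendsto (fun n : ℕ => ∫ ω, |(n : ℝ)⁻¹ * ∑ k ∈ Finset.range n, X k ω| ∂μ) atTop (𝓝 0) := by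
  have hM0 : 0 ≤ M := by
    obtain ⟨ω, hω⟩ := (hM 0).exists
    exact (abs_nonneg _).trans hω
  have hL (k) : MemLp (X k) 2 μ := MemLp.of_bound (hX k) M (hM k)
  have hint (j k) : Integrable (fun ω => X j ω * X k ω) μ := (hL j).integrable_mul (hL k)
  have hMM (j k) : |∫ ω, X j ω * X k ω ∂μ| ≤ M ^ 2 := by
    have hb : ∀ᵐ ω ∂μ, ‖X j ω * X k ω‖ ≤ M ^ 2 := by
      filter_upwards [hM j, hM k] with ω h₁ h₂
      rw [norm_mul, sq]
      exact mul_le_mul h₁ h₂ (norm_nonneg _) hM0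
    simpa using norm_integral_le_of_norm_le_const hb
  rw [Metric.tendsto_atTop]
  intro δ' hδ'
  set δ := δ' / 2 with hδdef
  have hδ : 0 < δ := by positivity
  obtain ⟨R, hR⟩ := hcov (δ ^ 2 / 2) (by positivity)
  -- Each row has at most 2R near-diagonal terms, of size at most M²; for n ≥ N they contribute at
  -- most nδ²/2, as do the remaining terms.
  obtain ⟨N, hN⟩ := exists_nat_gt (2 * (2 * R * M ^ 2) / δ ^ 2)
  refine ⟨N + 1, fun n hn => ?_⟩
  have hn0 : (0 : ℝ) < n := by exact_mod_cast (by omega : 0 < n)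
  have hnN : (N : ℝ) ≤ n := by exact_mod_cast (by omega : N ≤ n)
  have hSL : MemLp (fun ω => (n : ℝ)⁻¹ * ∑ k ∈ Finset.range n, X k ω) 2 μ :=
    (memLp_finsetSum _ fun k _ => hL k).const_mul _
  have hbound : ∫ ω, ((n : ℝ)⁻¹ * ∑ k ∈ Finset.range n, X k ω) ^ 2 ∂μ ≤ δ ^ 2 := by
    have hexp : ∫ ω, ((n : ℝ)⁻¹ * ∑ k ∈ Finset.range n, X k ω) ^ 2 ∂μ =
        (n : ℝ)⁻¹ ^ 2 * ∑ j ∈ Finset.range n, ∑ k ∈ Finset.range n, ∫ ω, X j ω * X k ω ∂μ := by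
      simp_rw [mul_pow, integral_const_mul, sq (∑ k ∈ Finset.range n, _),
        Finset.sum_mul_sum]
      rw [integral_finsetSum _ fun j _ => integrable_finsetSum _ fun k _ => hint j k]
      simp_rw [integral_finsetSum _ fun k _ => hint _ k]
    have hrow (j) : ∑ k ∈ Finset.range n, ∫ ω, X j ω * X k ω ∂μ
        ≤ 2 * R * M ^ 2 + n * (δ ^ 2 / 2) := by
      have hterm (k) : ∫ ω, X j ω * X k ω ∂μ ≤
          (if k ∈ Finset.Ico (j + 1 - R) (j + R) then M ^ 2 else 0) + δ ^ 2 / 2 := by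
        split_ifs with hk
        · have := (le_abs_self _).trans (hMM j k)
          have : 0 ≤ δ ^ 2 / 2 := by positivity
          linarith
        · rw [zero_add]
          rw [Finset.mem_Ico, not_and_or, not_le, not_lt] at hk
          rcases hk with hk | hk
          · simp_rw [mul_comm (X j _)]
            exact (le_abs_self _).trans (hR k j (by omega))
          · exact (le_abs_self _).trans (hR j k hk)
      calc _ ≤ ∑ k ∈ Finset.range n,
            ((if k ∈ Finset.Ico (j + 1 - R) (j + R) then M ^ 2 else 0) + δ ^ 2 / 2) :=
            Finset.sum_le_sum fun k _ => hterm k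
        _ ≤ _ := by
          rw [Finset.sum_add_distrib, Finset.sum_const, Finset.card_range, nsmul_eq_mul,
            ← Finset.sum_filter, Finset.sum_const, nsmul_eq_mul]
          have hcard : ((Finset.range n).filter
              fun k => k ∈ Finset.Ico (j + 1 - R) (j + R)).card ≤ 2 * R := by
            refine (Finset.card_le_card (fun k hk => (Finset.mem_filter.1 hk).2)).trans ?_
            rw [Nat.card_Ico]
            omega
          gcongr
          exact_mod_cast hcard
    have hsmall : 2 * R * M ^ 2 ≤ n * (δ ^ 2 / 2) := by
      have h := (hN.trans_le hnN).le
      rw [div_le_iff₀ (by positivity)] at h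
      linarith
    rw [hexp]
    calc _ ≤ (n : ℝ)⁻¹ ^ 2 * ∑ j ∈ Finset.range n, (n * (δ ^ 2 / 2) + n * (δ ^ 2 / 2)) := by
          gcongr with j
          exact (hrow j).trans (by gcongr)
      _ = δ ^ 2 := by
          rw [Finset.sum_const, Finset.card_range, nsmul_eq_mul]
          field_simp
          norm_num
  have := integral_abs_le_of_integral_sq_le hSL hδ hbound
  rw [Real.dist_eq, sub_zero, abs_of_nonneg (integral_nonneg fun _ => abs_nonneg _)]
  linarith

end Average

/-! ### Decorrelation from tail triviality. -/

namespace RandomField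

variable {Υ : Type*} [MeasurableSpace Υ] {P : Measure (Config Υ)} [IsProbabilityMeasure P]

/-- For J = ∅ the 0-1 law says that the tail is trivial, so conditioning f on the outside of a large
box nearly gives its mean; g is pulled out of that conditional expectation. -/
theorem exists_box_abs_integral_mul_sub_le (h01 : StrongZeroOneLaw P) {f : Config Υ → ℝ}
    (hf : MemLp f 2 P) {ε : ℝ} (hε : 0 < ε) :
    ∃ n, ∀ (g : Config Υ → ℝ) (M : ℝ), StronglyMeasurable[sigmaAt Υ (box n : Set Site)ᶜ] g →
      (∀ᵐ ω ∂P, |g ω| ≤ M) → |∫ ω, f ω * g ω ∂P - (∫ ω, f ω ∂P) * ∫ ω, g ω ∂P| ≤ ε * M := by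
  have h := tendsto_condExp_union_compl_box h01 hf ∅
  obtain ⟨n, hn⟩ := (h.eventually (gt_mem_nhds (ENNReal.ofReal_pos.2 hε))).exists
  have hbot : sigmaAt Υ (∅ : Set Site) = ⊥ := by simp [cylinderEvents]
  rw [hbot, condExp_bot, Set.empty_union] at hn
  refine ⟨n, fun g M hg hgM => ?_⟩
  have hmle : sigmaAt Υ (box n : Set Site)ᶜ ≤ MeasurableSpace.pi := cylinderEvents_le_pi
  have hfi : Integrable f P := hf.integrable one_le_two
  have hgm : AEStronglyMeasurable g P := (hg.mono hmle).aestronglyMeasurable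
  have hgi : Integrable g P := (MemLp.of_bound (p := 1) hgm M hgM).integrable le_rfl
  have hfg : Integrable (f * g) P := hfi.mul_bdd hgm hgM
  let D : Config Υ → ℝ := P[f | sigmaAt Υ (box n : Set Site)ᶜ] - fun _ => ∫ ω, f ω ∂P
  have hD : Integrable D P :=
    integrable_condExp.sub (integrable_const _)
  rw [eLpNorm_one_eq_lintegral_enorm, ← ofReal_integral_norm_eq_lintegral_enorm hD,
    ENNReal.ofReal_lt_ofReal_iff hε] at hn
  have hM0 : 0 ≤ M := by
    obtain ⟨ω, hω⟩ := hgM.exists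
    exact (abs_nonneg _).trans hω
  have e : ∫ ω, f ω * g ω ∂P - (∫ ω, f ω ∂P) * ∫ ω, g ω ∂P =
      ∫ ω, D ω * g ω ∂P := by
    have e₁ : ∫ ω, f ω * g ω ∂P = ∫ ω, (P[f | sigmaAt Υ (box n : Set Site)ᶜ] * g) ω ∂P := by
      rw [← integral_congr_ae (condExp_mul_of_stronglyMeasurable_right hg hfg hfi),
        integral_condExp hmle]
      rfl
    have hcg : Integrable (P[f | sigmaAt Υ (box n : Set Site)ᶜ] * g) P :=
      integrable_condExp.mul_bdd hgm hgM
    rw [e₁, ← integral_const_mul, ← integral_sub hcg (hgi.const_mul _)]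
    congr 1
    funext ω
    simp only [Pi.mul_apply, Pi.sub_apply, D]
    ring
  rw [e, ← Real.norm_eq_abs]
  calc _ ≤ ∫ ω, ‖D ω‖ * M ∂P := by
        refine norm_integral_le_of_norm_le (hD.norm.mul_const M) ?_
        filter_upwards [hgM] with ω hω
        rw [norm_mul]
        gcongr
        exact hω
    _ ≤ ε * M := by
        rw [integral_mul_const]
        exact mul_le_mul_of_nonneg_right hn.le hM0

end RandomField

/-! ### Averages over the rotating intercept. -/

namespace RandomField

section Rotation

variable {σ : Site ≃+ Site} {slope t : ℝ} {U : Set ℤ}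

theorem measurable_latticeApprox_inter_box (H : Set Site → ℝ) (N : ℕ) :
    Measurable fun t => H (latticeApprox σ slope t U ∩ box N) := by
  let b : ℝ → (box N → Prop) := fun t v => v.1 ∈ latticeApprox σ slope t U
  have hb : Measurable b := by
    refine measurable_pi_iff.2 fun v => measurableSet_setOfPred.1 ?_
    have hset : {t | b t v} = {_t : ℝ | (σ.symm v).1 ∈ U} ∩
        {t | ⌊slope * (σ.symm v).1 + t⌋ = (σ.symm v).2} := by
      ext t
      exact mem_latticeApprox
    rw [hset]
    refine (MeasurableSet.const _).inter ?_
    exact (Int.measurable_floor.comp (measurable_const.add measurable_id))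
      (measurableSet_singleton _)
  have h : (fun t => H (latticeApprox σ slope t U ∩ box N)) =
      (fun c : box N → Prop => H {v | ∃ h : v ∈ box N, c ⟨v, h⟩}) ∘ b := by
    funext t
    simp only [Function.comp_apply, b]
    congr 1
    ext v
    simp [and_comm]
  rw [h]
  exact (measurable_of_countable _).comp hb

theorem exists_forall_abs_inter_box_le (H : Set Site → ℝ) (N : ℕ) :
    ∃ M, ∀ J : Set Site, |H (J ∩ box N)| ≤ M := by
  have hfin : (Set.range fun J : Set Site => |H (J ∩ box N)|).Finite := by
    refine ((box N).finite_toSet.powerset.image fun K => |H K|).subset ?_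
    rintro _ ⟨J, rfl⟩
    exact ⟨_, Set.inter_subset_right, rfl⟩
  obtain ⟨M, hM⟩ := hfin.bddAbove
  exact ⟨M, fun J => hM ⟨J, rfl⟩⟩

/-- The floor is locally constant off the integers, and only finitely many sites matter. -/
theorem eventually_latticeApprox_inter_box_eq {N : ℕ}
    (ht : ∀ v ∈ box N, ∀ n : ℤ, slope * (σ.symm v).1 + t ≠ n) :
    ∀ᶠ s in 𝓝 t, latticeApprox σ slope s U ∩ box N = latticeApprox σ slope t U ∩ box N := by
  have h : ∀ᶠ s in 𝓝 t, ∀ v ∈ box N,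
      ⌊slope * (σ.symm v).1 + s⌋ = ⌊slope * (σ.symm v).1 + t⌋ := by
    rw [Filter.eventually_all_finset]
    intro v hv
    have hlt : (⌊slope * (σ.symm v).1 + t⌋ : ℝ) < slope * (σ.symm v).1 + t :=
      lt_of_le_of_ne (Int.floor_le _) (ht v hv _).symm
    have hc : Tendsto (fun s => slope * (σ.symm v).1 + s) (𝓝 t) (𝓝 (slope * (σ.symm v).1 + t)) :=
      tendsto_id.const_add _
    filter_upwards [hc.eventually (lt_mem_nhds hlt),
      hc.eventually (gt_mem_nhds (Int.lt_floor_add_one _))] with s h₁ h₂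
    exact Int.floor_eq_iff.2 ⟨h₁.le, h₂⟩
  filter_upwards [h] with s hs
  ext v
  simp only [Set.mem_inter_iff, mem_latticeApprox, Finset.mem_coe, and_congr_left_iff]
  intro hv
  rw [hs v hv]

theorem tendsto_average_latticeApprox_inter_box (hslope : Irrational slope) (a : ℝ)
    (H : Set Site → ℝ) (N : ℕ) :
    Tendsto (fun n : ℕ => (n : ℝ)⁻¹ * ∑ k ∈ Finset.range n,
      H (latticeApprox σ slope (Int.fract (slope * k + a)) U ∩ box N)) atTop
      (𝓝 (∫ t in (0 : ℝ)..1, H (latticeApprox σ slope t U ∩ box N))) := by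
  obtain ⟨M, hM⟩ := exists_forall_abs_inter_box_le H N
  let F : ℝ → ℝ := fun t => H (latticeApprox σ slope t U ∩ box N)
  have hper : Function.Periodic (fun t => F (Int.fract t)) (1 : ℝ) := fun t => by
    simp only [Int.fract_add_one]
  let G : UnitAddCircle → ℝ := hper.lift
  have hGcoe (t : ℝ) : G (t : UnitAddCircle) = F (Int.fract t) := hper.lift_coe t
  -- Jumps occur only at 0, where the fractional part jumps, and where the line meets a lattice
  -- height over the abscissa of a site of the box. The point 0 also makes D nonempty.
  let D : Set UnitAddCircle :=
    insert 0 ((fun v : Site => ((-(slope * (σ.symm v).1) : ℝ) : UnitAddCircle)) '' box N)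
  have hDfin : D.Finite := ((box N).finite_toSet.image _).insert 0
  have hGM (y : UnitAddCircle) : |G y| ≤ M := by
    induction y using QuotientAddGroup.induction_on with
    | H t => exact (congrArg abs (hGcoe t)).trans_le (hM _)
  have hGc : ContinuousOn G Dᶜ := by
    intro y hy
    refine ContinuousAt.continuousWithinAt ?_
    induction y using QuotientAddGroup.induction_on with
    | H t =>
      rw [← (QuotientAddGroup.isOpenQuotientMap_mk (N := AddSubgroup.zmultiples (1 : ℝ))
        ).continuousAt_comp_iff]
      have hcoe {r : ℝ} (h : ∃ n : ℤ, r = n) : (r : UnitAddCircle) = 0 := by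
        obtain ⟨n, rfl⟩ := h
        exact AddCircle.coe_eq_zero_iff 1 |>.2 ⟨n, by simp⟩
      have h₀ : ∀ n : ℤ, t ≠ n := fun n hn => hy (Or.inl (hcoe ⟨n, hn⟩))
      have h₁ : ∀ v ∈ box N, ∀ n : ℤ, slope * (σ.symm v).1 + Int.fract t ≠ n := by
        intro v hv n hn
        refine hy (Or.inr ⟨v, hv, ?_⟩)
        have h := hcoe (r := t - -(slope * (σ.symm v).1)) ⟨n + ⌊t⌋, by
          push_cast
          rw [← hn, Int.fract]
          ring⟩
        rw [AddCircle.coe_sub, sub_eq_zero] at h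
        exact h.symm
      have hfract : ContinuousAt (Int.fract : ℝ → ℝ) t := by
        refine continuousAt_id.sub ?_
        have hfl : ∀ᶠ s in 𝓝 t, ⌊s⌋ = ⌊t⌋ := by
          filter_upwards [lt_mem_nhds (lt_of_le_of_ne (Int.floor_le t) (h₀ _).symm),
            gt_mem_nhds (Int.lt_floor_add_one t)] with s h₁ h₂
          exact Int.floor_eq_iff.2 ⟨h₁.le, h₂⟩
        exact continuousAt_const.congr (hfl.mono fun s hs => by
          show (⌊t⌋ : ℝ) = ⌊s⌋
          rw [hs])
      have hev := hfract.tendsto.eventually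
        (eventually_latticeApprox_inter_box_eq (U := U) h₁)
      refine (continuousAt_const (y := F (Int.fract t))).congr (hev.mono fun s hs => ?_)
      show F (Int.fract t) = F (Int.fract s)
      simp only [F, hs]
  have h := tendsto_average_of_irrational_of_continuousOn hslope (a : UnitAddCircle) hDfin
    (Set.insert_nonempty _ _) hGM hGc
  have hint : ∫ x : UnitAddCircle, G x = ∫ t in (0 : ℝ)..1, F t := by
    rw [← UnitAddCircle.intervalIntegral_preimage 0 G, zero_add]
    refine intervalIntegral.integral_congr_ae ?_
    -- At t = 1 the fractional part is 0, so the two integrands may differ there.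
    have hne : ∀ᵐ t : ℝ, t ≠ 1 := by simp [ae_iff]
    filter_upwards [hne] with t ht hmem
    rw [Set.uIoc_of_le zero_le_one] at hmem
    rw [hGcoe, Int.fract_eq_self.2 ⟨hmem.1.le, lt_of_le_of_ne hmem.2 ht⟩]
  rw [hint] at h
  refine h.congr fun n => ?_
  congr 1
  refine Finset.sum_congr rfl fun k _ => ?_
  rw [show (a : UnitAddCircle) + k • (slope : UnitAddCircle) = ((slope * k + a : ℝ) : UnitAddCircle)
    by rw [AddCircle.coe_add, ← AddCircle.coe_nsmul, nsmul_eq_mul, add_comm, mul_comm], hGcoe]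

end Rotation

/-! ### Fluctuations of finite-memory informations along the line. -/

theorem exists_forall_abs_symm_fst_lt (σ : Site ≃+ Site) (F : Finset Site) :
    ∃ R : ℕ, ∀ v ∈ F, |(σ.symm v).1| < R := by
  obtain ⟨n, hn⟩ := exists_subset_box (F.image σ.symm)
  refine ⟨n + 1, fun v hv => ?_⟩
  have := (mem_box.1 (hn (Finset.mem_image_of_mem _ hv))).1
  push_cast
  omega

/-- In the coordinates of σ the difference has abscissa k - j, whatever the floors are. -/
theorem latticeSite_sub_notMem {σ : Site ≃+ Site} {F : Finset Site} {R : ℕ}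
    (hR : ∀ v ∈ F, |(σ.symm v).1| < R) (slope a : ℝ) {j k : ℕ} (hjk : j + R ≤ k) :
    latticeSite σ slope a k - latticeSite σ slope a j ∉ F := by
  intro h
  have h₁ := hR _ h
  rw [latticeSite, latticeSite, ← map_sub, AddEquiv.symm_apply_apply] at h₁
  simp only [Prod.fst_sub] at h₁
  have := (le_abs_self _).trans_lt h₁
  omega

theorem shift_shift {Υ : Type*} (u v : Site) (ω : Config Υ) :
    shift u (shift v ω) = shift (u + v) ω := by
  funext w
  simp [shift, add_assoc]

section Field

variable {Υ : Type*} [MeasurableSpace Υ]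

theorem measurable_shift_sigmaAt (W : Set Site) (v : Site) :
    Measurable[sigmaAt Υ ((fun u => u + v) '' W), sigmaAt Υ W] (shift v : Config Υ → Config Υ) := by
  rw [measurable_cylinderEvents_iff]
  intro u hu
  exact measurable_cylinderEvent_apply (Set.mem_image_of_mem _ hu)

variable [Fintype Υ] [DiscreteMeasurableSpace Υ] {P : Measure (Config Υ)}

theorem measurable_condInfo_sigmaAt (J : Set Site) :
    Measurable[sigmaAt Υ (insert 0 J)] (condInfo P J) := by
  rw [show condInfo P J = _ from funext (condInfo_eq_sum P J)]
  refine Finset.measurable_sum _ fun y _ => ?_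
  refine Measurable.mul (measurable_const.indicator ?_) ?_
  · exact measurable_cylinderEvent_apply (X := fun _ : Site => Υ) (Set.mem_insert 0 J)
      (MeasurableSet.of_discrete (s := {y}))
  · exact ((stronglyMeasurable_condExp (m := sigmaAt Υ J)).measurable.mono
      (cylinderEvents_mono (Set.subset_insert _ _)) le_rfl).log.neg

/-- The conditional information of the letter at the origin, minus its expectation. -/
noncomputable def centeredInfo (P : Measure (Config Υ)) (J : Set Site) (ω : Config Υ) : ℝ :=
  condInfo P J ω - ∫ η, condInfo P J η ∂P

theorem measurable_centeredInfo_sigmaAt (J : Set Site) :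
    Measurable[sigmaAt Υ (insert 0 J)] (centeredInfo P J) :=
  (measurable_condInfo_sigmaAt J).sub measurable_const

theorem measurable_centeredInfo (J : Set Site) : Measurable (centeredInfo P J) :=
  (measurable_centeredInfo_sigmaAt J).mono cylinderEvents_le_pi le_rfl

variable [IsProbabilityMeasure P]

theorem abs_integral_condInfo_le {c : ℝ} (hc0 : 0 < c) (hc : LetterLowerBound P c) {J : Set Site}
    (hJ : (0 : Site) ∉ J) : |∫ ω, condInfo P J ω ∂P| ≤ -Real.log c := by
  simpa using norm_integral_le_of_norm_le_const (μ := P) (f := condInfo P J)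
    (abs_condInfo_le hc0 hc hJ)

theorem abs_centeredInfo_le {c : ℝ} (hc0 : 0 < c) (hc : LetterLowerBound P c) {J : Set Site}
    (hJ : (0 : Site) ∉ J) : ∀ᵐ ω ∂P, |centeredInfo P J ω| ≤ 2 * -Real.log c := by
  filter_upwards [abs_condInfo_le hc0 hc hJ] with ω h
  have := abs_sub (condInfo P J ω) (∫ η, condInfo P J η ∂P)
  have h' := abs_integral_condInfo_le hc0 hc hJ
  rw [centeredInfo]
  linarith

theorem memLp_centeredInfo {c : ℝ} (hc0 : 0 < c) (hc : LetterLowerBound P c) {J : Set Site}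
    (hJ : (0 : Site) ∉ J) (p : ENNReal) : MemLp (centeredInfo P J) p P :=
  MemLp.of_bound (measurable_centeredInfo J).aestronglyMeasurable _ (abs_centeredInfo_le hc0 hc hJ)

theorem integral_centeredInfo {c : ℝ} (hc0 : 0 < c) (hc : LetterLowerBound P c) {J : Set Site}
    (hJ : (0 : Site) ∉ J) : ∫ ω, centeredInfo P J ω ∂P = 0 := by
  simp only [centeredInfo]
  rw [integral_sub ((memLp_condInfo hc0 hc hJ 1).integrable le_rfl) (integrable_const _)]
  simp

/-- Correlations of conditional informations with memory in a finite box decay uniformly. -/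
theorem exists_finset_abs_integral_centeredInfo_mul_le (hstat : Stationary P)
    (h01 : StrongZeroOneLaw P) {c : ℝ} (hc0 : 0 < c) (hc : LetterLowerBound P c) (N : ℕ)
    {ε : ℝ} (hε : 0 < ε) :
    ∃ F : Finset Site, ∀ v ∉ F, ∀ K K' : Set Site, K ⊆ box N → K' ⊆ box N → (0 : Site) ∉ K →
      (0 : Site) ∉ K' → |∫ ω, centeredInfo P K ω * centeredInfo P K' (shift v ω) ∂P| ≤ ε := by
  set M := 2 * -Real.log c with hMdef
  set δ := ε / (|M| + 1) with hδdef
  have hδ : 0 < δ := by positivity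
  have hex (K : Set Site) : ∃ n, (0 : Site) ∉ K → ∀ (g : Config Υ → ℝ) (M : ℝ),
      StronglyMeasurable[sigmaAt Υ (box n : Set Site)ᶜ] g → (∀ᵐ ω ∂P, |g ω| ≤ M) →
      |∫ ω, centeredInfo P K ω * g ω ∂P - (∫ ω, centeredInfo P K ω ∂P) * ∫ ω, g ω ∂P| ≤ δ * M := by
    by_cases hK : (0 : Site) ∈ K
    · exact ⟨0, fun h => absurd hK h⟩
    · obtain ⟨n, hn⟩ := exists_box_abs_integral_mul_sub_le h01 (memLp_centeredInfo hc0 hc hK 2) hδ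
      exact ⟨n, fun _ => hn⟩
  choose n hn using hex
  -- A box has finitely many subsets, so one radius serves every memory set K.
  obtain ⟨L, hL⟩ : ∃ L, ∀ K : Set Site, K ⊆ box N → n K ≤ L := by
    obtain ⟨L, hL⟩ := ((box N).finite_toSet.powerset.image n).bddAbove
    exact ⟨L, fun K hK => hL ⟨K, hK, rfl⟩⟩
  -- Outside this difference set, the shift carries the origin and K' clear of the box `box (n K)`.
  refine ⟨(box L ×ˢ insert 0 (box N)).image fun p => p.1 - p.2,
    fun v hv K K' hK hK' h0 h0' => ?_⟩
  have hsub : (fun u => u + v) '' insert 0 K' ⊆ (box (n K) : Set Site)ᶜ := by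
    rintro _ ⟨w, hw, rfl⟩ hmem
    refine hv (Finset.mem_image.2 ⟨(w + v, w), Finset.mem_product.2 ⟨?_, ?_⟩, by simp⟩)
    · exact box_mono (hL K hK) hmem
    · rcases hw with rfl | hw
      · exact Finset.mem_insert_self _ _
      · exact Finset.mem_insert_of_mem (hK' hw)
  have hg : StronglyMeasurable[sigmaAt Υ (box (n K) : Set Site)ᶜ]
      fun ω => centeredInfo P K' (shift v ω) :=
    (((measurable_centeredInfo_sigmaAt K').comp (measurable_shift_sigmaAt _ v)).mono
      (cylinderEvents_mono hsub) le_rfl).stronglyMeasurable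
  have hb : ∀ᵐ ω ∂P, |centeredInfo P K' (shift v ω)| ≤ M :=
    (hstat v).quasiMeasurePreserving.ae (abs_centeredInfo_le hc0 hc h0')
  have h := hn K h0 _ M hg hb
  rw [integral_centeredInfo hc0 hc h0, zero_mul, sub_zero] at h
  refine h.trans ?_
  calc δ * M ≤ δ * (|M| + 1) := by gcongr; linarith [le_abs_self M]
    _ = ε := by rw [hδdef]; field_simp

/-- The sets K k may vary with k since the correlation bound is uniform over subsets of the box;
stationarity reduces each covariance to the difference of the two sites. -/
theorem tendsto_integral_abs_average_centeredInfo (hstat : Stationary P)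
    (h01 : StrongZeroOneLaw P) {c : ℝ} (hc0 : 0 < c) (hc : LetterLowerBound P c)
    (σ : Site ≃+ Site) (slope a : ℝ) {N : ℕ} {K : ℕ → Set Site} (hK : ∀ k, K k ⊆ box N)
    (hK0 : ∀ k, (0 : Site) ∉ K k) :
    Tendsto (fun n : ℕ => ∫ ω, |(n : ℝ)⁻¹ * ∑ k ∈ Finset.range n,
      centeredInfo P (K k) (shift (latticeSite σ slope a k) ω)| ∂P) atTop (𝓝 0) := by
  refine tendsto_integral_abs_average (M := 2 * -Real.log c) (fun k =>
    ((measurable_centeredInfo _).comp (hstat _).measurable).aestronglyMeasurable)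
    (fun k => (hstat _).quasiMeasurePreserving.ae (abs_centeredInfo_le hc0 hc (hK0 k)))
    fun ε hε => ?_
  obtain ⟨F, hF⟩ := exists_finset_abs_integral_centeredInfo_mul_le hstat h01 hc0 hc N hε
  obtain ⟨R, hR⟩ := exists_forall_abs_symm_fst_lt σ F
  refine ⟨R, fun j k hjk => ?_⟩
  set u := latticeSite σ slope a j
  set w := latticeSite σ slope a k
  have h := hF (w - u) (latticeSite_sub_notMem hR slope a hjk) (K j) (K k) (hK j) (hK k)
    (hK0 j) (hK0 k)
  have hmeas : Measurable fun ω => centeredInfo P (K j) ω *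
      centeredInfo P (K k) (shift (w - u) ω) :=
    (measurable_centeredInfo _).mul ((measurable_centeredInfo _).comp (hstat _).measurable)
  have e := integral_map (μ := P) (hstat u).measurable.aemeasurable hmeas.aestronglyMeasurable
  rw [(hstat u).map_eq] at e
  rw [e] at h
  simpa only [shift_shift, sub_add_cancel] using h

end Field

end RandomField

/-! ### Assembling the L¹ ergodic theorem. -/

namespace RandomField

variable {Υ : Type*} [MeasurableSpace Υ] [Fintype Υ] [DiscreteMeasurableSpace Υ]
  {P : Measure (Config Υ)} [IsProbabilityMeasure P] {c : ℝ}

theorem abs_integral_condInfo_sub_le (hc0 : 0 < c) (hc : LetterLowerBound P c)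
    {J J' : Set Site} (hJ : (0 : Site) ∉ J) (hJ' : (0 : Site) ∉ J') :
    |∫ ω, condInfo P J ω ∂P - ∫ ω, condInfo P J' ω ∂P| ≤
      ∫ ω, |condInfo P J ω - condInfo P J' ω| ∂P := by
  rw [← integral_sub ((memLp_condInfo hc0 hc hJ 1).integrable le_rfl)
    ((memLp_condInfo hc0 hc hJ' 1).integrable le_rfl)]
  exact abs_integral_le_integral_abs

theorem zero_notMem_latticeApprox_inter {σ : Site ≃+ Site} {slope t : ℝ} (V : Set Site) :
    (0 : Site) ∉ latticeApprox σ slope t (Set.Iic (-1)) ∩ V :=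
  fun h => zero_notMem_latticeApprox (by simp) h.1

theorem exists_box_integral_condInfo_past_sub_lt (h01 : StrongZeroOneLaw P) (hc0 : 0 < c)
    (hc : LetterLowerBound P c) (σ : Site ≃+ Site) (slope : ℝ) {ε : ℝ} (hε : 0 < ε) :
    ∃ N, (∀ J J' : Set Site, (0 : Site) ∉ J → (0 : Site) ∉ J' → J ∩ box N = J' ∩ box N →
        ∫ ω, |condInfo P J ω - condInfo P J' ω| ∂P < ε) ∧
      ∀ t, |∫ ω, condInfo P (latticeApprox σ slope t (Set.Iic (-1)) ∩ box N) ω ∂P -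
        ∫ ω, condInfo P (latticeApprox σ slope t (Set.Iic (-1))) ω ∂P| < ε := by
  obtain ⟨N, hN⟩ := exists_box_integral_condInfo_sub_lt h01 hc0 hc hε
  refine ⟨N, hN, fun t => ?_⟩
  have h₀ := zero_notMem_latticeApprox (σ := σ) (slope := slope) (a := t) (U := Set.Iic (-1))
    (by simp)
  refine (abs_integral_condInfo_sub_le hc0 hc (zero_notMem_latticeApprox_inter _) h₀).trans_lt
    (hN _ _ (zero_notMem_latticeApprox_inter _) h₀ ?_)
  rw [Set.inter_assoc, Set.inter_self]

/-- The full past depends on infinitely many floors; measurability in t comes from a limit of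
box-restricted versions. -/
theorem measurable_integral_condInfo_past (h01 : StrongZeroOneLaw P) (hc0 : 0 < c)
    (hc : LetterLowerBound P c) (σ : Site ≃+ Site) (slope : ℝ) :
    Measurable fun t => ∫ ω, condInfo P (latticeApprox σ slope t (Set.Iic (-1))) ω ∂P := by
  choose N hN using fun j : ℕ => exists_box_integral_condInfo_past_sub_lt h01 hc0 hc σ slope
    (Nat.one_div_pos_of_nat (α := ℝ) (n := j))
  refine measurable_of_tendsto_metrizable (f := fun j t =>
    ∫ ω, condInfo P (latticeApprox σ slope t (Set.Iic (-1)) ∩ box (N j)) ω ∂P)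
    (fun j => measurable_latticeApprox_inter_box (fun K => ∫ ω, condInfo P K ω ∂P) (N j)) ?_
  refine tendsto_pi_nhds.2 fun t => tendsto_iff_norm_sub_tendsto_zero.2 ?_
  exact squeeze_zero (fun _ => norm_nonneg _) (fun j => ((hN j).2 t).le)
    tendsto_one_div_add_atTop_nhds_zero_nat

theorem intervalIntegrable_of_abs_le {f : ℝ → ℝ} (hf : Measurable f) {M : ℝ}
    (hM : ∀ t, |f t| ≤ M) (a b : ℝ) : IntervalIntegrable f volume a b :=
  (intervalIntegrable_const (c := M)).mono_fun hf.aestronglyMeasurable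
    (ae_of_all _ fun t => (hM t).trans (le_abs_self M))

theorem abs_integral_condInfo_past_le (hc0 : 0 < c)
    (hc : LetterLowerBound P c) (σ : Site ≃+ Site) (slope t : ℝ) :
    |∫ ω, condInfo P (latticeApprox σ slope t (Set.Iic (-1))) ω ∂P| ≤ -Real.log c :=
  abs_integral_condInfo_le hc0 hc (zero_notMem_latticeApprox (by simp))

/-- Abscissas of sites in the box are bounded by k₀, so a longer truncated past already fills the
box. -/
theorem latticeApprox_Ico_inter_box {σ : Site ≃+ Site} {N k₀ k : ℕ}
    (hk₀ : ∀ v ∈ box N, |(σ.symm v).1| < k₀) (hk : k₀ ≤ k) (slope t : ℝ) :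
    latticeApprox σ slope t (Set.Ico (-(k : ℤ)) 0) ∩ box N =
      latticeApprox σ slope t (Set.Iic (-1)) ∩ box N := by
  ext v
  simp only [Set.mem_inter_iff, mem_latticeApprox, Finset.mem_coe, and_congr_left_iff,
    Set.mem_Ico, Set.mem_Iic]
  intro hv _
  have := (abs_lt.1 (hk₀ v hv)).1
  omega

/-- The `L¹` ergodic theorem for the information along a line of irrational slope, for windows
starting at the origin. -/
theorem tendsto_integral_abs_information_sub (hstat : Stationary P)
    (h01 : StrongZeroOneLaw P) (hc0 : 0 < c) (hc : LetterLowerBound P c) {slope : ℝ}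
    (hslope : Irrational slope) (σ : Site ≃+ Site) (a : ℝ) :
    Tendsto (fun n : ℕ => ∫ ω, |(n : ℝ)⁻¹ *
        information P (latticeApprox σ slope a (Set.Ico 0 (n : ℤ))) ω -
      ∫ t in (0 : ℝ)..1, ∫ η, condInfo P (latticeApprox σ slope t (Set.Iic (-1))) η ∂P| ∂P)
      atTop (𝓝 0) := by
  rw [Metric.tendsto_atTop]
  intro ε' hε'
  -- Two parts pay for cutting the memory to the box, one for fluctuations, one for Weyl averaging
  -- and one for restoring the full past in the integral.
  set ε := ε' / 5 with hεdef
  have hε : 0 < ε := by positivity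
  obtain ⟨N, hN, hNt⟩ := exists_box_integral_condInfo_past_sub_lt h01 hc0 hc σ slope hε
  obtain ⟨k₀, hk₀⟩ := exists_forall_abs_symm_fst_lt σ (box N)
  set M := -Real.log c
  let Φ (t : ℝ) : ℝ := ∫ η, condInfo P (latticeApprox σ slope t (Set.Iic (-1))) η ∂P
  let ΦN (t : ℝ) : ℝ := ∫ η, condInfo P (latticeApprox σ slope t (Set.Iic (-1)) ∩ box N) η ∂P
  let τ (k : ℕ) : ℝ := Int.fract (slope * k + a)
  let J (k : ℕ) : Set Site := latticeApprox σ slope (τ k) (Set.Ico (-(k : ℤ)) 0)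
  let K (k : ℕ) : Set Site := latticeApprox σ slope (τ k) (Set.Iic (-1)) ∩ box N
  let u (k : ℕ) : Site := latticeSite σ slope a k
  have hJ0 (k) : (0 : Site) ∉ J k := zero_notMem_latticeApprox (by simp)
  have hK0 (k) : (0 : Site) ∉ K k := zero_notMem_latticeApprox_inter _
  let d (k : ℕ) (ω : Config Υ) : ℝ := |condInfo P (J k) ω - condInfo P (K k) ω|
  -- Crude bound for the early terms, whose past is still too short; it vanishes in the Cesàro mean.
  let e (k : ℕ) : ℝ := if k < k₀ then 2 * M else 0
  have hdint (k) : Integrable (d k) P :=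
    (((memLp_condInfo hc0 hc (hJ0 k) 1).sub (memLp_condInfo hc0 hc (hK0 k) 1)).integrable le_rfl).abs
  have hde (k) : ∫ ω, d k ω ∂P ≤ ε + e k := by
    by_cases hk : k < k₀
    · have hb : ∀ᵐ ω ∂P, ‖d k ω‖ ≤ 2 * M := by
        filter_upwards [abs_condInfo_le hc0 hc (hJ0 k), abs_condInfo_le hc0 hc (hK0 k)]
          with ω h₁ h₂
        have := abs_sub (condInfo P (J k) ω) (condInfo P (K k) ω)
        rw [Real.norm_eq_abs, abs_abs]
        linarith
      have := norm_integral_le_of_norm_le_const hb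
      rw [Real.norm_eq_abs, probReal_univ, mul_one] at this
      simp only [e, if_pos hk]
      linarith [le_abs_self (∫ ω, d k ω ∂P)]
    · simp only [e, if_neg hk, add_zero]
      refine (hN _ _ (hJ0 k) (hK0 k) ?_).le
      rw [Set.inter_assoc, Set.inter_self]
      exact latticeApprox_Ico_inter_box hk₀ (not_lt.1 hk) slope (τ k)
  have he : Tendsto (fun n : ℕ => (n : ℝ)⁻¹ * ∑ k ∈ Finset.range n, e k) atTop (𝓝 0) := by
    refine Filter.Tendsto.cesaro (tendsto_const_nhds.congr' ?_)
    filter_upwards [eventually_ge_atTop k₀] with k hk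
    simp [e, not_lt.2 hk]
  have hA := tendsto_integral_abs_average_centeredInfo hstat h01 hc0 hc σ slope a (N := N) (K := K)
    (fun k => Set.inter_subset_right) hK0
  have hB : Tendsto (fun n : ℕ => (n : ℝ)⁻¹ * ∑ k ∈ Finset.range n, ΦN (τ k)) atTop
      (𝓝 (∫ t in (0 : ℝ)..1, ΦN t)) :=
    tendsto_average_latticeApprox_inter_box hslope a (fun K => ∫ η, condInfo P K η ∂P) N
  have hI : |(∫ t in (0 : ℝ)..1, ΦN t) - ∫ t in (0 : ℝ)..1, Φ t| ≤ ε := by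
    rw [← intervalIntegral.integral_sub
      (intervalIntegrable_of_abs_le
        (measurable_latticeApprox_inter_box (fun K => ∫ η, condInfo P K η ∂P) N)
        (fun t => abs_integral_condInfo_le hc0 hc (zero_notMem_latticeApprox_inter _)) 0 1)
      (intervalIntegrable_of_abs_le (measurable_integral_condInfo_past h01 hc0 hc σ slope)
        (abs_integral_condInfo_past_le hc0 hc σ slope) 0 1)]
    have := intervalIntegral.norm_integral_le_of_norm_le_const (a := 0) (b := 1) (C := ε)
      (f := fun t => ΦN t - Φ t) fun t _ => (hNt t).le
    simpa using this
  obtain ⟨n₀, hn₀⟩ := eventually_atTop.1 (((he.eventually (gt_mem_nhds hε)).and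
    (hA.eventually (gt_mem_nhds hε))).and (Metric.tendsto_nhds.1 hB ε hε))
  refine ⟨n₀, fun n hn => ?_⟩
  obtain ⟨⟨h₁, h₂⟩, h₃⟩ := hn₀ n hn
  rw [Real.dist_eq] at h₃
  have hdu (k) : Integrable (fun ω => d k (shift (u k) ω)) P :=
    (hstat (u k)).integrable_comp_of_integrable (hdint k)
  have hSint : Integrable (fun ω => |(n : ℝ)⁻¹ * ∑ k ∈ Finset.range n,
      centeredInfo P (K k) (shift (u k) ω)|) P :=
    ((integrable_finsetSum _ fun k _ => (hstat (u k)).integrable_comp_of_integrable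
      ((memLp_centeredInfo hc0 hc (hK0 k) 1).integrable le_rfl)).const_mul _).abs
  have hDint : Integrable (fun ω => (n : ℝ)⁻¹ * ∑ k ∈ Finset.range n, d k (shift (u k) ω)) P :=
    (integrable_finsetSum _ fun k _ => hdu k).const_mul _
  have hD : ∫ ω, (n : ℝ)⁻¹ * ∑ k ∈ Finset.range n, d k (shift (u k) ω) ∂P ≤ 2 * ε := by
    have hshift (k) : ∫ ω, d k (shift (u k) ω) ∂P = ∫ ω, d k ω ∂P := by
      have hm : AEStronglyMeasurable (d k) (P.map (shift (u k))) := by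
        rw [(hstat (u k)).map_eq]
        exact (hdint k).aestronglyMeasurable
      have := integral_map (hstat (u k)).measurable.aemeasurable hm
      rw [(hstat (u k)).map_eq] at this
      exact this.symm
    rw [integral_const_mul, integral_finsetSum _ fun k _ => hdu k]
    simp only [hshift]
    calc _ ≤ (n : ℝ)⁻¹ * ∑ k ∈ Finset.range n, (ε + e k) := by
          gcongr with k
          exact hde k
      _ = (n : ℝ)⁻¹ * n * ε + (n : ℝ)⁻¹ * ∑ k ∈ Finset.range n, e k := by
          rw [Finset.sum_add_distrib, Finset.sum_const, Finset.card_range, nsmul_eq_mul]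
          ring
      _ ≤ 1 * ε + ε := by
          gcongr
          exact inv_mul_le_one
      _ = 2 * ε := by ring
  have hpt : ∀ᵐ ω ∂P, |(n : ℝ)⁻¹ *
      information P (latticeApprox σ slope a (Set.Ico 0 (n : ℤ))) ω - ∫ t in (0 : ℝ)..1, Φ t| ≤
      ((n : ℝ)⁻¹ * ∑ k ∈ Finset.range n, d k (shift (u k) ω) +
        |(n : ℝ)⁻¹ * ∑ k ∈ Finset.range n, centeredInfo P (K k) (shift (u k) ω)|) + 2 * ε := by
    filter_upwards [information_ae_eq_sum hstat σ slope a n] with ω hω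
    rw [hω]
    have hsplit : (n : ℝ)⁻¹ * ∑ k ∈ Finset.range n, condInfo P (J k) (shift (u k) ω) -
        ∫ t in (0 : ℝ)..1, Φ t =
        (n : ℝ)⁻¹ * ∑ k ∈ Finset.range n,
          (condInfo P (J k) (shift (u k) ω) - condInfo P (K k) (shift (u k) ω)) +
        (n : ℝ)⁻¹ * ∑ k ∈ Finset.range n, centeredInfo P (K k) (shift (u k) ω) +
        ((n : ℝ)⁻¹ * ∑ k ∈ Finset.range n, ΦN (τ k) - ∫ t in (0 : ℝ)..1, ΦN t) +
        ((∫ t in (0 : ℝ)..1, ΦN t) - ∫ t in (0 : ℝ)..1, Φ t) := by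
      simp only [centeredInfo, Finset.sum_sub_distrib]
      simp only [ΦN, K]
      ring
    have hdiff : |(n : ℝ)⁻¹ * ∑ k ∈ Finset.range n,
        (condInfo P (J k) (shift (u k) ω) - condInfo P (K k) (shift (u k) ω))| ≤
        (n : ℝ)⁻¹ * ∑ k ∈ Finset.range n, d k (shift (u k) ω) := by
      rw [abs_mul, abs_of_nonneg (by positivity : (0 : ℝ) ≤ (n : ℝ)⁻¹)]
      gcongr
      exact Finset.abs_sum_le_sum_abs _ _
    refine (congrArg abs hsplit).trans_le ?_
    refine (abs_add_le _ _).trans ?_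
    refine (add_le_add_left (abs_add_le _ _) _).trans ?_
    refine (add_le_add_left (add_le_add_left (abs_add_le _ _) _) _).trans ?_
    linarith
  have hleft : Integrable (fun ω => |(n : ℝ)⁻¹ *
      information P (latticeApprox σ slope a (Set.Ico 0 (n : ℤ))) ω - ∫ t in (0 : ℝ)..1, Φ t|) P :=
    ((((memLp_information P (latticeApprox_finite (Set.finite_Ico _ _)) 1).integrable
      le_rfl).const_mul _).sub (integrable_const _)).abs
  have hfinal := integral_mono_ae hleft ((hDint.add hSint).add (integrable_const _)) hpt
  rw [integral_add' (hDint.add hSint) (integrable_const _), integral_add' hDint hSint] at hfinal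
  rw [Real.dist_eq, sub_zero, abs_of_nonneg (integral_nonneg fun _ => abs_nonneg _)]
  simp only [integral_const, probReal_univ, one_smul] at hfinal
  have h₂' : ∫ ω, |(n : ℝ)⁻¹ * ∑ k ∈ Finset.range n,
      centeredInfo P (K k) (shift (u k) ω)| ∂P < ε := h₂
  calc _ ≤ _ := hfinal
    _ < ε' := by linarith

end RandomField

open RandomField
theorem theorem3p6 {Υ : Type*} [Fintype Υ] [MeasurableSpace Υ] [DiscreteMeasurableSpace Υ]
    (P : Measure (Config Υ)) [IsProbabilityMeasure P]
    (hstat : Stationary P) (hbdd : UniformLowerBound P) (h01 : StrongZeroOneLaw P)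
    (slope : ℝ) (hslope : Irrational slope) (σ : Site ≃+ Site) :
    (∀ t : ℝ, Integrable (fun ω => shannonEntropy (condLawZero P (past Υ σ slope t) ω)) P) ∧
    IntervalIntegrable
      (fun t : ℝ => ∫ ω, shannonEntropy (condLawZero P (past Υ σ slope t) ω) ∂P) volume 0 1 ∧
    ∀ a : ℝ,
      (∀ n : ℕ, MemLp (information P (latticeApprox σ slope a (Set.Icc 0 (n : ℤ)))) 1 P) ∧
      Tendsto
        (fun n : ℕ => eLpNorm
          (fun ω => 1 / ((n : ℝ) + 1) *
              information P (latticeApprox σ slope a (Set.Icc 0 (n : ℤ))) ω -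
            ∫ t in (0 : ℝ)..1,
              ∫ η, shannonEntropy (condLawZero P (past Υ σ slope t) η) ∂P)
          1 P)
        atTop (𝓝 0) := by
  obtain ⟨c, hc0, hc⟩ := hbdd
  have hent (t : ℝ) : ∫ ω, shannonEntropy (condLawZero P (past Υ σ slope t) ω) ∂P =
      ∫ ω, condInfo P (latticeApprox σ slope t (Set.Iic (-1))) ω ∂P :=
    (integral_condInfo hc0 hc (zero_notMem_latticeApprox (by simp))).symm
  refine ⟨fun t => integrable_shannonEntropy_condLawZero P _, ?_, fun a =>
    ⟨fun n => memLp_information P (latticeApprox_finite (Set.finite_Icc _ _)) 1, ?_⟩⟩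
  · simp only [hent]
    exact intervalIntegrable_of_abs_le (measurable_integral_condInfo_past h01 hc0 hc σ slope)
      (abs_integral_condInfo_past_le hc0 hc σ slope) 0 1
  · simp only [hent]
    -- The window {0, …, n} has n + 1 sites, so the limit is used at n + 1.
    have h := (tendsto_add_atTop_iff_nat 1).2
      (tendsto_integral_abs_information_sub hstat h01 hc0 hc hslope σ a)
    have h' := ENNReal.tendsto_ofReal h
    rw [ENNReal.ofReal_zero] at h'
    refine h'.congr fun n => ?_
    have hIcc : Set.Icc 0 (n : ℤ) = Set.Ico 0 ((n + 1 : ℕ) : ℤ) := by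
      ext z
      simp only [Set.mem_Icc, Set.mem_Ico]
      omega
    rw [hIcc, eLpNorm_one_eq_lintegral_enorm]
    have hint := (((memLp_information P (K := latticeApprox σ slope a (Set.Ico 0 ((n + 1 : ℕ) : ℤ)))
      (latticeApprox_finite (Set.finite_Ico _ _)) 1).integrable le_rfl).const_mul
        (1 / ((n : ℝ) + 1))).sub (integrable_const (∫ t in (0 : ℝ)..1,
          ∫ η, condInfo P (latticeApprox σ slope t (Set.Iic (-1))) η ∂P))
    refine Eq.trans ?_ (ofReal_integral_norm_eq_lintegral_enorm hint)
    simp only [Real.norm_eq_abs, one_div, Nat.cast_add, Nat.cast_one]
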